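/- Let $\mathbb{K}$ be a field. A simplicial complex $\Delta$ on a finite vertex set $V$ is a set of subsets of $V$ (its faces) closed under taking subsets; $\dim\Delta$ is the largest size of a face minus one, and for $\sigma\in\Delta$ we put $\operatorname{link}_\Delta\sigma=\{\tau\in\Delta:\sigma\cap\tau=\emptyset,\ \sigma\cup\tau\in\Delta\}$. Reduced simplicial homology $\tilde H_j$ is taken with coefficients in $\mathbb{K}$, with $\tilde H_{-1}(\{\emptyset\})=\mathbb{K}$. The complex $\Delta$ is called a *PR complex* if for every $j$ and all faces $\sigma,\tau\in\Delta$ with $\tilde H_j(\operatorname{link}_\Delta\sigma)\ne 0\ne \tilde H_j(\operatorname{link}_\Delta\tau)$ we have $|\sigma|=|\tau|$. For such a complex (with at least one face), let $p$ be the largest index for which some face $\sigma$ has $\tilde H_{p-1}(\operatorname{link}_\Delta\sigma)\neq 0$, for $0\le j\le p$ let $s_j$ be the size of the faces $\sigma$ with $\tilde H_{j-1}(\operatorname{link}_\Delta\sigma)\ne 0$ (such faces exist), and let $d_j=s_{j-1}-s_j$ for $1\le j\le p$. The sequence $(d_p,\dots,d_1)$ is called the *degree type* of $\Delta$. For an integer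 $i\ge 1$ let $S=\{u_\tau:\tau\in\Delta,\ |\tau|\ge\dim\Delta+2-i\}$ be a set of new vertices, one for each such face $\tau$, and let $\varphi_i(\Delta)$ be the simplicial complex on $V\sqcup S$ obtained by adding to $\Delta$ all faces $\sigma\sqcup\{u_{\tau_1},\dots,u_{\tau_r}\}$ for chains $\sigma\subseteq\tau_1\subsetneq\dots\subsetneq\tau_r$ of faces of $\Delta$ with $u_{\tau_1},\dots,u_{\tau_r}\in S$. **Theorem.** Let $p\ge i\ge 1$, and let $\Delta$ be a PR complex on $V$ with degree type $(d_p,\dots,d_i,\underbrace{1,\dots,1}_{i-1})$. Then $\varphi_i(\Delta)$ is a PR complex with degree type $(d_p,\dots,d_{i+1},d_i+1,\underbrace{1,\dots,1}_{i-1})$. -/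

import Mathlib

/-- A simplicial complex with vertices in `V`: a set of finite subsets of `V` (the faces) that is
closed under passing to subsets. The empty set counts as a face, singletons need not be faces, and
the complex without any face is allowed. -/
abbrev SimplicialComplexOn (V : Type*) := LowerSet (Finset V)

namespace SimplicialComplexOn

/-- The dimension of a complex on a finite vertex set: the largest size of a face, minus one. -/
noncomputable def dim {V : Type*} (Δ : SimplicialComplexOn V) : ℤ :=
  (sSup (Finset.card '' (Δ : Set (Finset V))) : ℕ) - 1

/-- The link of `f` in `Δ`. -/
def link {V : Type*} [DecidableEq V] (Δ : SimplicialComplexOn V) (f : Finset V) :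
    SimplicialComplexOn V where
  carrier := {σ | σ ∈ Δ ∧ Disjoint f σ ∧ f ∪ σ ∈ Δ}
  lower' := fun _ _ hba ha =>
    ⟨Δ.lower hba ha.1, ha.2.1.mono_right hba, Δ.lower (Finset.union_subset_union_right hba) ha.2.2⟩

section Homology

variable (K : Type*) [Field K] {V : Type*}

/-- The oriented simplex `v₀ ∧ ⋯ ∧ vₙ₋₁` on the vertices of the tuple `v`, an element of the
exterior algebra of the vector space with basis `V`. It changes by the sign of a permutation of the
vertices, vanishes if a vertex is repeated, and is `1` for the empty tuple. -/
noncomputable def orientedSimplex {n : ℕ} (v : Fin n → V) : ExteriorAlgebra K (V →₀ K) :=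
  ExteriorAlgebra.ιMulti K n (fun j => Finsupp.single (v j) (1 : K))

/-- The simplicial boundary map: contraction with the functional that takes the value `1` on each
vertex. On oriented simplices it is the usual alternating sum, see `boundary_orientedSimplex`. -/
noncomputable def boundary :
    ExteriorAlgebra K (V →₀ K) →ₗ[K] ExteriorAlgebra K (V →₀ K) :=
  CliffordAlgebra.contractLeft (Finsupp.linearCombination K (fun _ : V => (1 : K)))

theorem boundary_orientedSimplex {n : ℕ} (v : Fin (n + 1) → V) :
    boundary K (orientedSimplex K v) =
      ∑ j : Fin (n + 1), (-1 : K) ^ (j : ℕ) • orientedSimplex K (fun k => v (j.succAbove k)) := by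
  induction n with
  | zero =>
    simp [orientedSimplex, boundary, ExteriorAlgebra.ιMulti_apply,
      CliffordAlgebra.contractLeft_ι, ExteriorAlgebra.ι]
  | succ n ih =>
    have key : ∀ {m : ℕ} (w : Fin (m + 1) → V), orientedSimplex K w =
        CliffordAlgebra.ι 0 (Finsupp.single (w 0) (1 : K)) *
          orientedSimplex K (fun k => w k.succ) := by
      intro m w
      simp only [orientedSimplex, ExteriorAlgebra.ιMulti_succ_apply]
      rfl
    rw [key v]
    have h := ih (fun k => v k.succ)
    unfold boundary at h ⊢
    rw [CliffordAlgebra.contractLeft_ι_mul, h, Finset.mul_sum, Fin.sum_univ_succ (n := n + 1)]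
    simp only [Finsupp.linearCombination_single, smul_eq_mul, mul_one, one_smul, Fin.val_zero,
      pow_zero, Fin.zero_succAbove, Fin.val_succ, sub_eq_add_neg, ← Finset.sum_neg_distrib]
    congr 1
    refine Finset.sum_congr rfl fun j _ => ?_
    rw [key (fun k => v (j.succ.succAbove k))]
    simp [pow_succ, Fin.succ_succAbove_succ]

/-- The space of oriented simplicial chains of `Δ` of dimension `n - 1`, spanned by the oriented
simplices on `n` vertices whose vertex set is a face of `Δ`. For `n = 0` this is the augmentation
term, spanned by the empty face. -/
noncomputable def chains [DecidableEq V] (Δ : SimplicialComplexOn V) (n : ℕ) :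
    Submodule K (ExteriorAlgebra K (V →₀ K)) :=
  Submodule.span K {x | ∃ v : Fin n → V, Finset.univ.image v ∈ Δ ∧ x = orientedSimplex K v}

/-- The reduced cycles of dimension `n - 1`. -/
noncomputable def cycles [DecidableEq V] (Δ : SimplicialComplexOn V) (n : ℕ) :
    Submodule K (ExteriorAlgebra K (V →₀ K)) :=
  chains K Δ n ⊓ LinearMap.ker (boundary K)

/-- The boundaries of dimension `n - 1`. -/
noncomputable def boundaries [DecidableEq V] (Δ : SimplicialComplexOn V) (n : ℕ) :
    Submodule K (ExteriorAlgebra K (V →₀ K)) :=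
  (chains K Δ (n + 1)).map (boundary K)

theorem boundaries_le_cycles [DecidableEq V] (Δ : SimplicialComplexOn V) (n : ℕ) :
    boundaries K Δ n ≤ cycles K Δ n := by
  refine le_inf ?_ ?_
  · rw [boundaries, chains, Submodule.map_span, Submodule.span_le]
    rintro _ ⟨_, ⟨v, hv, rfl⟩, rfl⟩
    rw [boundary_orientedSimplex]
    refine Submodule.sum_mem _ fun j _ => Submodule.smul_mem _ _ (Submodule.subset_span ?_)
    refine ⟨_, Δ.lower ?_ hv, rfl⟩
    intro x hx
    simp only [Finset.mem_image, Finset.mem_univ, true_and] at hx ⊢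
    exact ⟨_, hx.choose_spec⟩
  · rintro _ ⟨x, _, rfl⟩
    exact CliffordAlgebra.contractLeft_contractLeft _ _

/-- The reduced simplicial homology `H̃ₙ₋₁(Δ; K)`. The index is shifted by one: `n = 0` is degree
`-1`, `n = 1` is degree `0`, and so on (in degrees below `-1` reduced homology is zero). -/
abbrev reducedHomologyPred [DecidableEq V] (Δ : SimplicialComplexOn V) (n : ℕ) :=
  cycles K Δ n ⧸ (boundaries K Δ n).submoduleOf (cycles K Δ n)

end Homology

/-- `σ` is a face of `Δ` such that `H̃ₙ₋₁(link_Δ σ; K) ≠ 0`. -/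
def LinkHasHomology (K : Type*) [Field K] {V : Type*} [DecidableEq V]
    (Δ : SimplicialComplexOn V) (n : ℕ) (σ : Finset V) : Prop :=
  σ ∈ Δ ∧ Nontrivial (reducedHomologyPred K (Δ.link σ) n)

/-- `Δ` is a PR complex over `K`: faces whose links have nonzero reduced homology in the same degree
have the same size. -/
def IsPR (K : Type*) [Field K] {V : Type*} [DecidableEq V] (Δ : SimplicialComplexOn V) : Prop :=
  ∀ (n : ℕ) (σ τ : Finset V),
    LinkHasHomology K Δ n σ → LinkHasHomology K Δ n τ → σ.card = τ.card

/-- `Δ` has degree type `(d p, …, d 1)` over `K`; only the values `d j` with `1 ≤ j ≤ p` matter.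
Here `p` is the largest index such that some face has a link with nonzero `H̃ₚ₋₁`, `s j` is the size
of the faces whose link has nonzero `H̃ⱼ₋₁` (for `0 ≤ j ≤ p`), and `d j = s (j - 1) - s j`. -/
def HasDegreeType (K : Type*) [Field K] {V : Type*} [DecidableEq V] (Δ : SimplicialComplexOn V)
    (p : ℕ) (d : ℕ → ℕ) : Prop :=
  IsGreatest {n : ℕ | ∃ σ, LinkHasHomology K Δ n σ} p ∧
  ∃ s : ℕ → ℕ,
    (∀ j ≤ p, (∃ σ, LinkHasHomology K Δ j σ) ∧ ∀ σ, LinkHasHomology K Δ j σ → σ.card = s j) ∧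
    ∀ j, 1 ≤ j → j ≤ p → (d j : ℤ) = (s (j - 1) : ℤ) - (s j : ℤ)

/-- The set `S` of faces `τ` of `Δ` with `|τ| ≥ dim Δ + 2 - i`; the element `τ` stands for the new
vertex `u_τ`. -/
def NewVertex {V : Type*} (i : ℕ) (Δ : SimplicialComplexOn V) :=
  {τ : Finset V // τ ∈ Δ ∧ Δ.dim + 2 - (i : ℤ) ≤ (τ.card : ℤ)}

instance {V : Type*} [DecidableEq V] (i : ℕ) (Δ : SimplicialComplexOn V) :
    DecidableEq (NewVertex i Δ) :=
  inferInstanceAs (DecidableEq {τ : Finset V // τ ∈ Δ ∧ Δ.dim + 2 - (i : ℤ) ≤ (τ.card : ℤ)})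

/-- The complex `φ_i(Δ)` on the vertex set `V ⊔ S`. Its faces are the sets `σ ⊔ {u_τ₁, …, u_τᵣ}`
with `σ ∈ Δ`, `r ≥ 0` and `τ₁ ⊂ ⋯ ⊂ τᵣ` a chain of elements of `S`, all of which contain `σ`. -/
def phi {V : Type*} (i : ℕ) (Δ : SimplicialComplexOn V) :
    SimplicialComplexOn (V ⊕ NewVertex i Δ) where
  carrier := {F | F.toLeft ∈ Δ ∧ (∀ τ ∈ F.toRight, F.toLeft ⊆ τ.1) ∧
    ∀ τ ∈ F.toRight, ∀ τ' ∈ F.toRight, τ.1 ⊆ τ'.1 ∨ τ'.1 ⊆ τ.1}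
  lower' := fun _ _ hba ha =>
    ⟨Δ.lower (Finset.toLeft_subset_toLeft hba) ha.1,
      fun τ hτ => (Finset.toLeft_subset_toLeft hba).trans
        (ha.2.1 τ (Finset.toRight_subset_toRight hba hτ)),
      fun τ hτ τ' hτ' => ha.2.2 τ (Finset.toRight_subset_toRight hba hτ) τ'
        (Finset.toRight_subset_toRight hba hτ')⟩

end SimplicialComplexOn

set_option linter.unusedSectionVars false

/-! The reduced homology of the link of a face `F` in degree `n - 1` is the homology of the family
of all faces containing `F`, graded by size, at size `n + |F|`. Everything is therefore phrased as
exactness (`ExactAt`) of a family of finite sets, with the boundary truncated to the family.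
Order-convex families can be cut into a lower and an upper part, or fibred over a poset
(`ExactAt.of_fibers`).

Write a face of `φ_i(Δ)` as `F = σ ⊔ C`, and let `m = s_{i-1} = dim Δ + 2 - i`, the least size
allowed for a face that carries a new vertex.

If `|σ| < m`, fibre the star of `F` over the set `D` of new vertices. For `D ≠ ∅` the fibre is a
Boolean interval from `σ` to the smallest face in `D`, which is strictly larger than `σ`, so it is
exact. Hence there is no homology for `C ≠ ∅`, and for `C = ∅` it is that of `link_Δ σ`.

If `|σ| ≥ m`, fibre over the part `ρ` in `V`. The fibre is a cone with apex `u_ρ` unless `u_ρ ∈ C`;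
then chains strictly above `ρ` remain, and these are controlled by links of `Δ` through a
subdivision argument and induction on `|C|` (`exactAt_strictFiberFaces`). Faces of `Δ` of size at
least `m` have link homology only at total size `s_0`, so the star of `F` is exact up to size `s_0`,
while no face of `φ_i(Δ)` has more than `s_0 + 1` elements. Hence homology forces `C ≠ ∅`, `n + |F|
= s_0 + 1` and `n < i`, so `|F| = s_n + 1`; the faces `τ ⊔ {u_τ}` show that these cases occur. Thus
exactly the `s_n` with `n < i` grow by one, which changes `d_i` alone. -/

namespace SimplicialComplexOn

/-! ### Signed wedge and contraction operators on functions of faces. -/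

section Operators

variable (K : Type*) [Field K] {W : Type*} [DecidableEq W] (r : W → ℕ)

/-- The sign attached to the position of `v` relative to `F`, in the order given by `r`. -/
def faceSign (v : W) (F : Finset W) : K := (-1) ^ (F.filter (fun w => r w < r v)).card

theorem faceSign_mul_self (v : W) (F : Finset W) : faceSign K r v F * faceSign K r v F = 1 := by
  rw [faceSign, ← mul_pow]
  simp

theorem faceSign_ne_zero (v : W) (F : Finset W) : faceSign K r v F ≠ 0 := by
  intro h
  simpa [h] using faceSign_mul_self K r v F

theorem faceSign_insert_self (v : W) (F : Finset W) :
    faceSign K r v (insert v F) = faceSign K r v F := by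
  simp [faceSign, Finset.filter_insert]

theorem faceSign_erase_self (v : W) (F : Finset W) :
    faceSign K r v (F.erase v) = faceSign K r v F := by
  by_cases h : v ∈ F
  · rw [← faceSign_insert_self, Finset.insert_erase h]
  · rw [Finset.erase_eq_of_notMem h]

theorem faceSign_insert {v w : W} {F : Finset W} (hw : w ∉ F) :
    faceSign K r v (insert w F) = (if r w < r v then -1 else 1) * faceSign K r v F := by
  unfold faceSign
  rw [Finset.filter_insert]
  split_ifs with h
  · rw [Finset.card_insert_of_notMem (by simp [hw]), pow_succ]
    ring
  · simp

theorem faceSign_eq_erase {v w : W} {F : Finset W} (hw : w ∈ F) :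
    faceSign K r v F = (if r w < r v then -1 else 1) * faceSign K r v (F.erase w) := by
  rw [← faceSign_insert K r (Finset.notMem_erase w F), Finset.insert_erase hw]

/-- Exterior multiplication by the vertex `v`, on functions of faces. -/
def wedge (v : W) : (Finset W → K) →ₗ[K] (Finset W → K) where
  toFun f F := if v ∈ F then faceSign K r v F * f (F.erase v) else 0
  map_add' f g := by
    ext F
    simp only [Pi.add_apply]
    split_ifs <;> ring
  map_smul' c f := by
    ext F
    simp only [Pi.smul_apply, smul_eq_mul, RingHom.id_apply]
    split_ifs <;> ring

/-- Contraction by the vertex `v`, on functions of faces. -/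
def contract (v : W) : (Finset W → K) →ₗ[K] (Finset W → K) where
  toFun f F := if v ∈ F then 0 else faceSign K r v F * f (insert v F)
  map_add' f g := by
    ext F
    simp only [Pi.add_apply]
    split_ifs <;> ring
  map_smul' c f := by
    ext F
    simp only [Pi.smul_apply, smul_eq_mul, RingHom.id_apply]
    split_ifs <;> ring

variable {K r}

theorem wedge_apply (v : W) (f : Finset W → K) (F : Finset W) :
    wedge K r v f F = if v ∈ F then faceSign K r v F * f (F.erase v) else 0 := rfl

theorem contract_apply (v : W) (f : Finset W → K) (F : Finset W) :
    contract K r v f F = if v ∈ F then 0 else faceSign K r v F * f (insert v F) := rfl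

theorem wedge_wedge_self (v : W) (f : Finset W → K) : wedge K r v (wedge K r v f) = 0 := by
  ext F
  simp [wedge_apply]

theorem wedge_wedge_comm (hr : Function.Injective r) (v w : W) (f : Finset W → K) :
    wedge K r v (wedge K r w f) + wedge K r w (wedge K r v f) = 0 := by
  obtain rfl | hvw := eq_or_ne v w
  · simp [wedge_wedge_self]
  ext F
  simp only [Pi.add_apply, Pi.zero_apply, wedge_apply, Finset.mem_erase]
  by_cases hv : v ∈ F <;> by_cases hw : w ∈ F <;> simp [hv, hw, hvw, hvw.symm]
  rw [faceSign_eq_erase K r (v := v) hw, faceSign_eq_erase K r (v := w) hv,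
    Finset.erase_right_comm (a := v)]
  rcases lt_or_gt_of_ne (hr.ne hvw) with h | h
  · simp only [h, h.not_gt, if_true, if_false]
    ring
  · simp only [h, h.not_gt, if_true, if_false]
    ring

theorem contract_wedge_self (v : W) (f : Finset W → K) :
    contract K r v (wedge K r v f) + wedge K r v (contract K r v f) = f := by
  ext F
  by_cases hv : v ∈ F
  · simp [wedge_apply, contract_apply, hv, faceSign_erase_self, ← mul_assoc, faceSign_mul_self]
  · simp [wedge_apply, contract_apply, hv, faceSign_insert_self, ← mul_assoc, faceSign_mul_self]

theorem contract_wedge_of_ne (hr : Function.Injective r) {v w : W} (hvw : v ≠ w)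
    (f : Finset W → K) :
    contract K r w (wedge K r v f) + wedge K r v (contract K r w f) = 0 := by
  ext F
  by_cases hv : v ∈ F <;> by_cases hw : w ∈ F <;>
    simp [wedge_apply, contract_apply, hv, hw, hvw, hvw.symm]
  rw [faceSign_insert K r hw, faceSign_eq_erase K r (v := w) hv,
    Finset.erase_insert_of_ne hvw.symm]
  rcases lt_or_gt_of_ne (hr.ne hvw) with h | h
  · simp only [h, h.not_gt, if_true, if_false]
    ring
  · simp only [h, h.not_gt, if_true, if_false]
    ring

variable [Fintype W] (K r)

/-- The simplicial boundary operator on functions of faces. -/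
def faceBoundary : (Finset W → K) →ₗ[K] (Finset W → K) := ∑ v, contract K r v

variable {K r}

theorem faceBoundary_apply (f : Finset W → K) (F : Finset W) :
    faceBoundary K r f F = ∑ v, contract K r v f F := by
  simp [faceBoundary]

/-- Contractions at other vertices anticommute with the wedge by `v`, and the one at `v` contributes
the identity. So the wedge by `v` is a contracting homotopy wherever the family permits it. -/
theorem faceBoundary_wedge (hr : Function.Injective r) (v : W) (f : Finset W → K) :
    faceBoundary K r (wedge K r v f) = f - wedge K r v (faceBoundary K r f) := by
  rw [eq_sub_iff_add_eq]
  simp only [faceBoundary, LinearMap.sum_apply, map_sum]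
  rw [← Finset.sum_add_distrib, Finset.sum_eq_single v, contract_wedge_self]
  · intro w _ hw
    exact contract_wedge_of_ne hr hw.symm f
  · simp

variable (K r) in
/-- Exterior multiplication by a linear combination of vertices. -/
noncomputable def wedgeLinear : (W →₀ K) →ₗ[K] Module.End K (Finset W → K) :=
  Finsupp.linearCombination K (fun v => wedge K r v)

theorem wedgeLinear_sq (hr : Function.Injective r) (m : W →₀ K) :
    wedgeLinear K r m * wedgeLinear K r m = 0 := by
  induction m using Finsupp.induction_linear with
  | zero => simp
  | single v a =>
    apply LinearMap.ext
    intro f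
    simp [wedgeLinear, wedge_wedge_self]
  | add m n hm hn =>
    -- The cross terms of the square form an anticommutator, which is bilinear and so can be checked
    -- on vertices; no division by 2 is needed.
    have key : ∀ m n : W →₀ K, wedgeLinear K r m * wedgeLinear K r n
        + wedgeLinear K r n * wedgeLinear K r m = 0 := by
      intro m n
      induction m using Finsupp.induction_linear with
      | zero => simp
      | add a b ha hb =>
        rw [map_add, add_mul, mul_add, add_add_add_comm, ha, hb, add_zero]
      | single v a =>
        induction n using Finsupp.induction_linear with
        | zero => simp
        | add c d hc hd =>
          rw [map_add, add_mul, mul_add, add_add_add_comm, hc, hd, add_zero]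
        | single w b =>
          apply LinearMap.ext
          intro f
          have := wedge_wedge_comm (K := K) hr v w f
          simp only [wedgeLinear, Finsupp.linearCombination_single, LinearMap.add_apply,
            Module.End.mul_apply, LinearMap.smul_apply, map_smul, LinearMap.zero_apply]
          rw [smul_comm b a, ← smul_add, ← smul_add, this, smul_zero, smul_zero]
    rw [map_add, add_mul, mul_add, mul_add, hm, hn, zero_add, add_zero, key]

/-! ### Comparison with the exterior algebra. -/

variable (K) in
/-- The exterior algebra acts on functions of faces. -/
noncomputable def faceAction (hr : Function.Injective r) :
    ExteriorAlgebra K (W →₀ K) →ₐ[K] Module.End K (Finset W → K) :=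
  ExteriorAlgebra.lift K ⟨wedgeLinear K r, wedgeLinear_sq hr⟩

variable (K) in
/-- Coordinates of elements of the exterior algebra, up to signs. -/
noncomputable def toFaces (hr : Function.Injective r) :
    ExteriorAlgebra K (W →₀ K) →ₗ[K] (Finset W → K) :=
  (LinearMap.applyₗ (Pi.single ∅ 1)).comp (faceAction K hr).toLinearMap

theorem toFaces_algebraMap (hr : Function.Injective r) (c : K) :
    toFaces K hr (algebraMap K _ c) = c • Pi.single ∅ 1 := by
  simp only [toFaces, LinearMap.comp_apply, AlgHom.toLinearMap_apply, AlgHom.commutes,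
    LinearMap.applyₗ_apply_apply]
  rfl

theorem toFaces_ι_mul (hr : Function.Injective r) (m : W →₀ K) (x : ExteriorAlgebra K (W →₀ K)) :
    toFaces K hr (CliffordAlgebra.ι 0 m * x) = wedgeLinear K r m (toFaces K hr x) := by
  have h : faceAction K hr (CliffordAlgebra.ι 0 m) = wedgeLinear K r m :=
    ExteriorAlgebra.lift_ι_apply K _ _ m
  simp only [toFaces, LinearMap.comp_apply, AlgHom.toLinearMap_apply, map_mul,
    LinearMap.applyₗ_apply_apply, Module.End.mul_apply, h]

theorem faceBoundary_wedgeLinear (hr : Function.Injective r) (m : W →₀ K) (f : Finset W → K) :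
    faceBoundary K r (wedgeLinear K r m f) =
      Finsupp.linearCombination K (fun _ : W => (1 : K)) m • f -
        wedgeLinear K r m (faceBoundary K r f) := by
  induction m using Finsupp.induction_linear with
  | zero => simp
  | add a b ha hb =>
    simp only [map_add, LinearMap.add_apply, ha, hb, add_smul]
    abel
  | single v a =>
    simp [wedgeLinear, faceBoundary_wedge hr, smul_sub]

/-- Both boundaries obey the same Leibniz rule for left multiplication by a vector and vanish on
scalars. -/
theorem toFaces_boundary (hr : Function.Injective r) (x : ExteriorAlgebra K (W →₀ K)) :
    toFaces K hr (boundary K x) = faceBoundary K r (toFaces K hr x) := by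
  induction x using CliffordAlgebra.left_induction with
  | algebraMap c =>
    rw [boundary, CliffordAlgebra.contractLeft_algebraMap]
    have h := toFaces_algebraMap hr c
    rw [h, map_zero, map_smul]
    ext F
    simp [faceBoundary_apply, contract_apply]
  | add x y hx hy => simp only [map_add, hx, hy]
  | ι_mul x m hx =>
    have h := toFaces_ι_mul hr m x
    rw [h, faceBoundary_wedgeLinear hr, ← hx, ← toFaces_ι_mul, ← map_smul, ← map_sub]
    congr 1
    exact CliffordAlgebra.contractLeft_ι_mul _ m x

theorem orientedSimplex_succ {m : ℕ} (w : Fin (m + 1) → W) : orientedSimplex K w =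
    CliffordAlgebra.ι 0 (Finsupp.single (w 0) (1 : K)) *
      orientedSimplex K (fun k => w k.succ) := by
  simp only [orientedSimplex, ExteriorAlgebra.ιMulti_succ_apply]
  rfl

theorem toFaces_orientedSimplex_succ (hr : Function.Injective r) {n : ℕ} (v : Fin (n + 1) → W) :
    toFaces K hr (orientedSimplex K v) =
      wedge K r (v 0) (toFaces K hr (orientedSimplex K (fun k => v k.succ))) := by
  rw [orientedSimplex_succ, toFaces_ι_mul]
  simp [wedgeLinear]

theorem image_fin_succ {n : ℕ} (v : Fin (n + 1) → W) :
    Finset.univ.image v = insert (v 0) (Finset.univ.image (fun k : Fin n => v k.succ)) := by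
  ext x
  simp [Fin.exists_fin_succ, eq_comm]

theorem toFaces_orientedSimplex_zero (hr : Function.Injective r) (v : Fin 0 → W) :
    toFaces K hr (orientedSimplex K v) = Pi.single ∅ 1 := by
  have h := toFaces_algebraMap (K := K) hr 1
  rw [map_one, one_smul] at h
  simp [orientedSimplex, ExteriorAlgebra.ιMulti_apply, h]

theorem toFaces_orientedSimplex_support (hr : Function.Injective r) {n : ℕ} (v : Fin n → W)
    (F : Finset W) (hF : toFaces K hr (orientedSimplex K v) F ≠ 0) :
    F = Finset.univ.image v ∧ F.card = n := by
  induction n generalizing F with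
  | zero =>
    rw [toFaces_orientedSimplex_zero, Pi.single_apply] at hF
    have : F = ∅ := by
      by_contra h
      simp [h] at hF
    subst this
    simp
  | succ n ih =>
    rw [toFaces_orientedSimplex_succ, wedge_apply] at hF
    split_ifs at hF with h
    · obtain ⟨h1, h2⟩ := ih _ _ (right_ne_zero_of_mul hF)
      rw [image_fin_succ, ← h1, Finset.insert_erase h]
      refine ⟨rfl, ?_⟩
      rw [← Finset.card_erase_add_one h, h2]
    · exact absurd rfl hF

theorem toFaces_orientedSimplex_image (hr : Function.Injective r) {n : ℕ} (v : Fin n → W)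
    (hv : Function.Injective v) :
    toFaces K hr (orientedSimplex K v) (Finset.univ.image v) ≠ 0 := by
  induction n with
  | zero =>
    rw [toFaces_orientedSimplex_zero, Finset.univ_eq_empty, Finset.image_empty]
    simp
  | succ n ih =>
    rw [toFaces_orientedSimplex_succ, wedge_apply, image_fin_succ, if_pos (by simp),
      Finset.erase_insert]
    · exact mul_ne_zero (faceSign_ne_zero _ _ _ _)
        (ih _ (hv.comp (Fin.succ_injective n)))
    · simp [hv.eq_iff, Fin.succ_ne_zero]

/-- Functions supported on the members of `Q` of size `k`. -/
def chainsOn (K : Type*) [Field K] (Q : Set (Finset W)) (k : ℕ) : Submodule K (Finset W → K) where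
  carrier := {f | ∀ F, f F ≠ 0 → F ∈ Q ∧ F.card = k}
  add_mem' {f g} hf hg F h := by
    by_cases h1 : f F = 0
    · exact hg F (by simpa [h1] using h)
    · exact hf F h1
  zero_mem' F h := absurd rfl h
  smul_mem' c f hf F h := hf F (right_ne_zero_of_mul h)

theorem single_mem_map_chains (hr : Function.Injective r) (X : SimplicialComplexOn W)
    {F : Finset W} (hF : F ∈ X) :
    Pi.single F 1 ∈ (chains K X F.card).map (toFaces K hr) := by
  let v : Fin F.card → W := fun j => (F.equivFin.symm j : W)
  have hv : Function.Injective v := Subtype.val_injective.comp F.equivFin.symm.injective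
  have him : Finset.univ.image v = F := by
    ext x
    simp only [Finset.mem_image, Finset.mem_univ, true_and, v]
    constructor
    · rintro ⟨j, rfl⟩
      exact (F.equivFin.symm j).2
    · intro hx
      exact ⟨F.equivFin ⟨x, hx⟩, by simp⟩
  have h0 := toFaces_orientedSimplex_image (K := K) hr v hv
  rw [him] at h0
  -- The simplex on an enumeration of `F` is supported at `F` alone, with nonzero coefficient;
  -- dividing by it normalizes the value to 1.
  refine ⟨(toFaces K hr (orientedSimplex K v) F)⁻¹ • orientedSimplex K v,
    Submodule.smul_mem _ _ (Submodule.subset_span ⟨v, by rwa [him], rfl⟩), ?_⟩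
  rw [map_smul]
  ext G
  by_cases hG : G = F
  · subst hG
    simp [h0]
  · have : toFaces K hr (orientedSimplex K v) G = 0 := by
      by_contra h
      exact hG (((toFaces_orientedSimplex_support hr v G h).1).trans him)
    simp [hG, this]

theorem map_chains (hr : Function.Injective r) (X : SimplicialComplexOn W) (n : ℕ) :
    (chains K X n).map (toFaces K hr) = chainsOn K (X : Set (Finset W)) n := by
  apply le_antisymm
  · rw [chains, Submodule.map_span, Submodule.span_le]
    rintro _ ⟨_, ⟨v, hv, rfl⟩, rfl⟩ F hF
    obtain ⟨h1, h2⟩ := toFaces_orientedSimplex_support hr v F hF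
    exact ⟨h1 ▸ hv, h2⟩
  · intro f hf
    have : f = ∑ F, f F • Pi.single F 1 := by
      ext G
      simp [Finset.sum_apply, Pi.single_apply]
    rw [this]
    refine Submodule.sum_mem _ fun F _ => ?_
    by_cases h : f F = 0
    · simp [h]
    · obtain ⟨h1, rfl⟩ := hf F h
      exact Submodule.smul_mem _ _ (single_mem_map_chains hr X h1)

theorem toFaces_surjective (hr : Function.Injective r) : Function.Surjective (toFaces K hr) := by
  rw [← LinearMap.range_eq_top, eq_top_iff]
  intro f _
  have : f = ∑ F, f F • Pi.single F 1 := by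
    ext G
    simp [Finset.sum_apply, Pi.single_apply]
  rw [this]
  refine Submodule.sum_mem _ fun F _ => Submodule.smul_mem _ _ ?_
  obtain ⟨x, -, hx⟩ := single_mem_map_chains (K := K) hr ⊤ (F := F) trivial
  exact ⟨x, hx⟩

/-- A surjection between spaces of the same finite dimension, namely the number of subsets of `W`.
-/
theorem toFaces_injective (hr : Function.Injective r) : Function.Injective (toFaces K hr) := by
  classical
  let _ : LinearOrder W := LinearOrder.lift' r hr
  let b := (Finsupp.basisSingleOne (R := K) (ι := W)).ExteriorAlgebra
  have : Module.Finite K (ExteriorAlgebra K (W →₀ K)) := Module.Finite.of_basis b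
  refine (LinearMap.injective_iff_surjective_of_finrank_eq_finrank ?_).2 (toFaces_surjective hr)
  rw [Module.finrank_eq_card_basis b, Module.finrank_fintype_fun_eq_card]

theorem faceBoundary_faceBoundary (hr : Function.Injective r) (f : Finset W → K) :
    faceBoundary K r (faceBoundary K r f) = 0 := by
  obtain ⟨x, rfl⟩ := toFaces_surjective hr f
  rw [← toFaces_boundary, ← toFaces_boundary]
  have : boundary K (boundary K x) = 0 := CliffordAlgebra.contractLeft_contractLeft _ _
  rw [this, map_zero]

/-! ### Exactness of families of faces. -/

variable (K r) in
/-- Exactness, in degree `k`, of the complex of functions on a family `Q` of finite sets which is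
graded by the number of elements. -/
def ExactAt (Q : Set (Finset W)) (k : ℕ) : Prop :=
  ∀ f ∈ chainsOn K Q k, (∀ F ∈ Q, faceBoundary K r f F = 0) →
    ∃ g ∈ chainsOn K Q (k + 1), ∀ F ∈ Q, faceBoundary K r g F = f F

theorem faceBoundary_ne_zero {f : Finset W → K} {F : Finset W} (h : faceBoundary K r f F ≠ 0) :
    ∃ v ∉ F, f (insert v F) ≠ 0 := by
  rw [faceBoundary_apply] at h
  obtain ⟨v, -, hv⟩ := Finset.exists_ne_zero_of_sum_ne_zero h
  rw [contract_apply] at hv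
  split_ifs at hv with h1
  · exact absurd rfl hv
  · exact ⟨v, h1, right_ne_zero_of_mul hv⟩

theorem faceBoundary_eq_zero_of_notMem {X : SimplicialComplexOn W} {n : ℕ} {f : Finset W → K}
    (hf : f ∈ chainsOn K (X : Set (Finset W)) n) {F : Finset W} (hF : F ∉ X) :
    faceBoundary K r f F = 0 := by
  by_contra h
  obtain ⟨v, -, hv⟩ := faceBoundary_ne_zero h
  exact hF (X.lower (Finset.subset_insert v F) (hf _ hv).1)

/-- `toFaces` is an isomorphism matching chains and boundaries. Truncating to `X` loses nothing,
because boundaries of chains on a complex vanish off the complex. -/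
theorem nontrivial_reducedHomologyPred_iff (hr : Function.Injective r) (X : SimplicialComplexOn W)
    (n : ℕ) : Nontrivial (reducedHomologyPred K X n) ↔ ¬ ExactAt K r (X : Set (Finset W)) n := by
  rw [Submodule.Quotient.nontrivial_iff, ← not_iff_not, not_not, not_not,
    Submodule.submoduleOf, Submodule.comap_subtype_eq_top]
  constructor
  · intro h f hf hf0
    rw [← map_chains hr] at hf
    obtain ⟨x, hx, rfl⟩ := hf
    have hx0 : boundary K x = 0 := by
      apply toFaces_injective (K := K) hr
      rw [toFaces_boundary, map_zero]
      ext F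
      by_cases hF : F ∈ X
      · exact hf0 F hF
      · exact faceBoundary_eq_zero_of_notMem
          (map_chains (K := K) hr X n ▸ Submodule.mem_map_of_mem (f := toFaces K hr) hx) hF
    obtain ⟨y, hy, hyx⟩ := h ⟨hx, hx0⟩
    refine ⟨toFaces K hr y, map_chains (K := K) hr X _ ▸
      Submodule.mem_map_of_mem (f := toFaces K hr) hy, fun F _ => ?_⟩
    rw [← toFaces_boundary, hyx]
  · rintro h x ⟨hx, hx0⟩
    have hx' : toFaces K hr x ∈ chainsOn K (X : Set (Finset W)) n := map_chains (K := K) hr X n ▸ Submodule.mem_map_of_mem (f := toFaces K hr) hx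
    obtain ⟨g, hg, hgf⟩ := h _ hx' (by
      intro F _
      rw [← toFaces_boundary, LinearMap.mem_ker.1 hx0, map_zero]
      rfl)
    have hg' := hg
    rw [← map_chains hr] at hg'
    obtain ⟨y, hy, rfl⟩ := hg'
    refine ⟨y, hy, toFaces_injective (K := K) hr ?_⟩
    rw [toFaces_boundary]
    ext F
    by_cases hF : F ∈ X
    · exact hgf F hF
    · rw [faceBoundary_eq_zero_of_notMem hg hF]
      by_contra h
      exact hF (hx' F (Ne.symm h)).1

end Operators

end SimplicialComplexOn

namespace SimplicialComplexOn

/-! ### Cutting, fibring, coning and shifting families. -/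

section Exactness

variable {K : Type*} [Field K] {W : Type*} [DecidableEq W] [Fintype W] {r : W → ℕ}

theorem exactAt_of_forall_card_ne {Q : Set (Finset W)} {k : ℕ} (h : ∀ F ∈ Q, F.card ≠ k) :
    ExactAt K r Q k := by
  intro f hf _
  have hf0 : f = 0 := by
    ext F
    by_contra h0
    exact h F (hf F h0).1 (hf F h0).2
  exact ⟨0, Submodule.zero_mem _, by simp [hf0]⟩

theorem indicator_mem_chainsOn {Q A : Set (Finset W)} {k : ℕ} {f : Finset W → K}
    (hf : f ∈ chainsOn K Q k) : A.indicator f ∈ chainsOn K (Q ∩ A) k := by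
  intro F hF
  have hA : F ∈ A := Set.mem_of_indicator_ne_zero hF
  rw [Set.indicator_of_mem hA] at hF
  exact ⟨⟨(hf F hF).1, hA⟩, (hf F hF).2⟩

theorem chainsOn_mono {Q Q' : Set (Finset W)} (h : Q ⊆ Q') (k : ℕ) :
    chainsOn K Q k ≤ chainsOn K Q' k := fun _ hf F hF => ⟨h (hf F hF).1, (hf F hF).2⟩

theorem indicator_faceBoundary_mem_chainsOn {Q : Set (Finset W)} {k : ℕ} {f : Finset W → K}
    (hf : f ∈ chainsOn K Q (k + 1)) : Q.indicator (faceBoundary K r f) ∈ chainsOn K Q k := by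
  intro F hF
  have hQ : F ∈ Q := Set.mem_of_indicator_ne_zero hF
  rw [Set.indicator_of_mem hQ] at hF
  obtain ⟨v, hv, hv'⟩ := faceBoundary_ne_zero hF
  refine ⟨hQ, ?_⟩
  have := (hf _ hv').2
  rw [Finset.card_insert_of_notMem hv] at this
  omega

theorem faceBoundary_eq_zero_of_upper {Q B : Set (Finset W)} {k : ℕ}
    (hB : ∀ F ∈ B ∩ Q, ∀ G ∈ Q, F ⊆ G → G ∈ B) {f : Finset W → K}
    (hf : f ∈ chainsOn K (Q \ B) k) {F : Finset W} (hF : F ∈ B ∩ Q) :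
    faceBoundary K r f F = 0 := by
  by_contra h
  obtain ⟨v, -, hv⟩ := faceBoundary_ne_zero h
  have := (hf _ hv).1
  exact this.2 (hB F hF _ this.1 (Finset.subset_insert _ _))

/-- The truncated boundary squares to zero by convexity: an intermediate face outside `Q` would lie
between two members of `Q`. -/
theorem faceBoundary_indicator_faceBoundary (hr : Function.Injective r) {Q : Set (Finset W)}
    (hQ : Q.OrdConnected) {k : ℕ} {f : Finset W → K} (hf : f ∈ chainsOn K Q k)
    {F : Finset W} (hF : F ∈ Q) :
    faceBoundary K r (Q.indicator (faceBoundary K r f)) F = 0 := by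
  have h0 := congrFun (faceBoundary_faceBoundary (K := K) hr f) F
  rw [Pi.zero_apply, faceBoundary_apply] at h0
  rw [faceBoundary_apply, ← h0]
  refine Finset.sum_congr rfl fun v _ => ?_
  rw [contract_apply, contract_apply]
  split_ifs with hv
  · rfl
  · by_cases hvQ : insert v F ∈ Q
    · rw [Set.indicator_of_mem hvQ]
    · rw [Set.indicator_of_notMem hvQ]
      have : faceBoundary K r f (insert v F) = 0 := by
        by_contra h
        obtain ⟨w, -, hw⟩ := faceBoundary_ne_zero h
        exact hvQ (hQ.out hF (hf _ hw).1
          ⟨Finset.subset_insert _ _, Finset.subset_insert _ _⟩)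
      rw [this]

theorem faceBoundary_indicator_of_upper {Q B : Set (Finset W)} {k : ℕ}
    (hB : ∀ F ∈ B ∩ Q, ∀ G ∈ Q, F ⊆ G → G ∈ B) {f : Finset W → K} (hf : f ∈ chainsOn K Q k)
    {F : Finset W} (hF : F ∈ B ∩ Q) :
    faceBoundary K r (B.indicator f) F = faceBoundary K r f F := by
  have h1 : f = B.indicator f + Bᶜ.indicator f := (Set.indicator_self_add_compl B f).symm
  conv_rhs => rw [h1, map_add, Pi.add_apply]
  rw [faceBoundary_eq_zero_of_upper (k := k) hB (f := Bᶜ.indicator f) ?_ hF, add_zero]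
  exact indicator_mem_chainsOn hf

theorem sub_indicator_mem_chainsOn_diff {Q B : Set (Finset W)} {k : ℕ} {f g : Finset W → K}
    (hf : f ∈ chainsOn K Q k) (hg : Q.indicator g ∈ chainsOn K Q k)
    (h : ∀ F ∈ Q ∩ B, g F = f F) : f - Q.indicator g ∈ chainsOn K (Q \ B) k := by
  intro F hF
  obtain ⟨h2, h3⟩ := Submodule.sub_mem _ hf hg F hF
  refine ⟨⟨h2, fun h4 => hF ?_⟩, h3⟩
  rw [Pi.sub_apply, Set.indicator_of_mem h2, h F ⟨h2, h4⟩, sub_self]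

/-- If the lower part and the upper part of a family are exact, then so is the family. -/
theorem ExactAt.of_diff_of_inter (hr : Function.Injective r) {Q B : Set (Finset W)}
    (hQ : Q.OrdConnected) {k : ℕ} (hB : ∀ F ∈ B ∩ Q, ∀ G ∈ Q, F ⊆ G → G ∈ B)
    (hA : ExactAt K r (Q \ B) k) (hB' : ExactAt K r (Q ∩ B) k) : ExactAt K r Q k := by
  intro f hf hf0
  obtain ⟨g, hg, hgf⟩ := hB' (B.indicator f) (indicator_mem_chainsOn hf)
    (fun F hF => by rw [faceBoundary_indicator_of_upper hB hf hF.symm, hf0 F hF.1])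
  have hgQ : g ∈ chainsOn K Q (k + 1) := chainsOn_mono Set.inter_subset_left _ hg
  have hgf' : ∀ F ∈ Q ∩ B, faceBoundary K r g F = f F := fun F hF => by
    rw [hgf F hF, Set.indicator_of_mem hF.2]
  -- Subtracting the truncated boundary of `g` leaves a cycle supported on the lower part.
  obtain ⟨e, he, hef⟩ := hA _ (sub_indicator_mem_chainsOn_diff hf
    (indicator_faceBoundary_mem_chainsOn hgQ) hgf') (fun F hF => by
      rw [map_sub, Pi.sub_apply, hf0 F hF.1,
        faceBoundary_indicator_faceBoundary hr hQ hgQ hF.1, sub_zero])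
  refine ⟨g + e, Submodule.add_mem _ hgQ (chainsOn_mono Set.sdiff_subset _ he), fun F hF => ?_⟩
  rw [map_add, Pi.add_apply]
  by_cases hFB : F ∈ B
  · rw [hgf' F ⟨hF, hFB⟩, faceBoundary_eq_zero_of_upper hB he ⟨hFB, hF⟩, add_zero]
  · rw [hef F ⟨hF, hFB⟩, Pi.sub_apply, Set.indicator_of_mem hF, add_sub_cancel]

/-- The lower part of an exact family is exact if the upper part is exact one degree higher. -/
theorem ExactAt.diff_of_inter (hr : Function.Injective r) {Q B : Set (Finset W)}
    (hQ : Q.OrdConnected) {k : ℕ} (hB : ∀ F ∈ B ∩ Q, ∀ G ∈ Q, F ⊆ G → G ∈ B)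
    (hA : ExactAt K r Q k) (hB' : ExactAt K r (Q ∩ B) (k + 1)) : ExactAt K r (Q \ B) k := by
  intro f hf hf0
  have hB0 : ∀ F ∈ Q ∩ B, f F = 0 := fun F hF => by
    by_contra h
    exact (hf F h).1.2 hF.2
  obtain ⟨g, hg, hgf⟩ := hA f (chainsOn_mono Set.sdiff_subset _ hf) (fun F hF => by
    by_cases hFB : F ∈ B
    · exact faceBoundary_eq_zero_of_upper hB hf ⟨hFB, hF⟩
    · exact hf0 F ⟨hF, hFB⟩)
  -- The part of the primitive `g` in `B` is a cycle one degree higher; subtracting the truncated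
  -- boundary of `w` moves `g` off `B`.
  obtain ⟨w, hw, hwg⟩ := hB' (B.indicator g) (indicator_mem_chainsOn hg) (fun F hF => by
    rw [faceBoundary_indicator_of_upper hB hg hF.symm, hgf F hF.1, hB0 F hF])
  have hwQ : w ∈ chainsOn K Q (k + 1 + 1) := chainsOn_mono Set.inter_subset_left _ hw
  refine ⟨_, sub_indicator_mem_chainsOn_diff (B := B) hg
    (indicator_faceBoundary_mem_chainsOn hwQ) (fun F hF => by
      rw [hwg F hF, Set.indicator_of_mem hF.2]), fun F hF => ?_⟩
  rw [map_sub, Pi.sub_apply, hgf F hF.1, faceBoundary_indicator_faceBoundary hr hQ hwQ hF.1,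
    sub_zero]

/-- A family is exact if the fibers of a monotone map are. -/
theorem ExactAt.of_fibers (hr : Function.Injective r) {P : Type*} [PartialOrder P]
    {π : Finset W → P} (hπ : Monotone π) {Q : Set (Finset W)} (hQ : Q.OrdConnected) {k : ℕ}
    (h : ∀ F ∈ Q, ExactAt K r {G ∈ Q | π G = π F} k) : ExactAt K r Q k := by
  induction hn : Q.ncard using Nat.strong_induction_on generalizing Q with
  | _ n ih =>
    obtain rfl | hne := Q.eq_empty_or_nonempty
    · exact exactAt_of_forall_card_ne (by simp)
    -- A fibre over a maximal value is an upper part of `Q`, and removing it keeps the family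
    -- convex.
    obtain ⟨_, hp⟩ := (Set.toFinite (π '' Q)).exists_maximal (hne.image π)
    obtain ⟨⟨F, hF, rfl⟩, hmax⟩ := hp
    have hmax' : ∀ G ∈ Q, π F ≤ π G → π G = π F := fun G hG hle =>
      le_antisymm (hmax ⟨G, hG, rfl⟩ hle) hle
    refine ExactAt.of_diff_of_inter hr hQ (B := {G | π G = π F}) ?_ ?_ (h F hF)
    · rintro G ⟨hG, -⟩ H hH hGH
      exact hmax' H hH ((show π G = π F from hG) ▸ hπ hGH)
    · refine ih _ ?_ ?_ ?_ rfl
      · rw [← hn]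
        refine Set.ncard_lt_ncard ⟨Set.sdiff_subset, fun hsub => (hsub hF).2 rfl⟩
      · refine ⟨fun G hG H hH E hE => ⟨hQ.out hG.1 hH.1 hE, fun hEp => hH.2 ?_⟩⟩
        exact hmax' H hH.1 ((show π E = π F from hEp) ▸ hπ hE.2)
      · intro G hG
        convert h G hG.1 using 1
        ext E
        simp only [Set.mem_sdiff, Set.mem_ofPred_eq]
        constructor
        · exact fun hE => ⟨hE.1.1, hE.2⟩
        · exact fun hE => ⟨⟨hE.1, fun hEp => hG.2 (hE.2.symm.trans hEp)⟩, hE.2⟩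

/-- Such a family is a cone with apex `v`, and the wedge by `v` provides primitives. -/
theorem ExactAt.of_toggle (hr : Function.Injective r) (v : W) {Q : Set (Finset W)} (k : ℕ)
    (hi : ∀ F ∈ Q, insert v F ∈ Q) (he : ∀ F ∈ Q, F.erase v ∈ Q) : ExactAt K r Q k := by
  intro f hf hf0
  refine ⟨wedge K r v f, fun F hF => ?_, fun F hF => ?_⟩
  · rw [wedge_apply] at hF
    split_ifs at hF with hv
    · obtain ⟨h1, h2⟩ := hf _ (right_ne_zero_of_mul hF)
      refine ⟨Finset.insert_erase hv ▸ hi _ h1, ?_⟩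
      rw [← Finset.card_erase_add_one hv, h2]
    · exact absurd rfl hF
  · rw [faceBoundary_wedge hr, Pi.sub_apply, wedge_apply, hf0 _ (he F hF)]
    simp

theorem wedge_mem_chainsOn {v : W} {Q : Set (Finset W)} {k : ℕ} {f : Finset W → K}
    (hf : f ∈ chainsOn K Q k) : wedge K r v f ∈ chainsOn K (insert v '' Q) (k + 1) := by
  intro F hF
  rw [wedge_apply] at hF
  split_ifs at hF with hv
  · obtain ⟨h1, h2⟩ := hf _ (right_ne_zero_of_mul hF)
    refine ⟨⟨_, h1, Finset.insert_erase hv⟩, ?_⟩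
    rw [← Finset.card_erase_add_one hv, h2]
  · exact absurd rfl hF

theorem exists_wedge_eq {v : W} {Q : Set (Finset W)} (hQ : ∀ F ∈ Q, v ∉ F) {k : ℕ}
    {f : Finset W → K} (hf : f ∈ chainsOn K (insert v '' Q) (k + 1)) :
    ∃ g ∈ chainsOn K Q k, wedge K r v g = f := by
  refine ⟨contract K r v f, fun F hF => ?_, ?_⟩
  · rw [contract_apply] at hF
    split_ifs at hF with hv
    · exact absurd rfl hF
    · obtain ⟨⟨G, hG, hGF⟩, h2⟩ := hf _ (right_ne_zero_of_mul hF)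
      rw [Finset.card_insert_of_notMem hv, Nat.add_right_cancel_iff] at h2
      have : G = F := by
        rw [← Finset.erase_insert (hQ G hG), hGF, Finset.erase_insert hv]
      exact ⟨this ▸ hG, h2⟩
  · have h := contract_wedge_self (K := K) (r := r) v f
    have h0 : wedge K r v f = 0 := by
      ext F
      rw [wedge_apply]
      split_ifs with hv
      · by_contra h
        obtain ⟨⟨G, -, hG⟩, -⟩ := hf _ (right_ne_zero_of_mul h)
        exact Finset.notMem_erase v F (hG ▸ Finset.mem_insert_self v G)
      · rfl
    rwa [h0, map_zero, zero_add] at h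

theorem faceBoundary_wedge_insert (hr : Function.Injective r) {v : W} {Q : Set (Finset W)}
    (hQ : ∀ F ∈ Q, v ∉ F) {k : ℕ} {f : Finset W → K} (hf : f ∈ chainsOn K Q k) {F : Finset W}
    (hF : F ∈ Q) :
    faceBoundary K r (wedge K r v f) (insert v F) = -(faceSign K r v F * faceBoundary K r f F) := by
  have h0 : f (insert v F) = 0 := by
    by_contra h
    exact hQ _ (hf _ h).1 (Finset.mem_insert_self v F)
  rw [faceBoundary_wedge hr, Pi.sub_apply, h0, wedge_apply, if_pos (Finset.mem_insert_self v F),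
    Finset.erase_insert (hQ F hF), faceSign_insert_self, zero_sub]

/-- The wedge by `v` identifies the two complexes with a shift by one. Contraction at `v` leaves the
shifted family, so the boundaries agree up to signs, which account for the negated primitives. -/
theorem exactAt_insert_image_iff (hr : Function.Injective r) {v : W} {Q : Set (Finset W)}
    (hQ : ∀ F ∈ Q, v ∉ F) (k : ℕ) :
    ExactAt K r (insert v '' Q) (k + 1) ↔ ExactAt K r Q k := by
  have hw : ∀ f : Finset W → K, ∀ F ∈ Q, wedge K r v f (insert v F) = faceSign K r v F * f F := by
    intro f F hF
    rw [wedge_apply, if_pos (Finset.mem_insert_self v F), Finset.erase_insert (hQ F hF),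
      faceSign_insert_self]
  constructor
  · intro h f hf hf0
    obtain ⟨g, hg, hgf⟩ := h (wedge K r v f) (wedge_mem_chainsOn hf) (by
      rintro _ ⟨F, hF, rfl⟩
      rw [faceBoundary_wedge_insert hr hQ hf hF, hf0 F hF, mul_zero, neg_zero])
    obtain ⟨e, he, rfl⟩ := exists_wedge_eq (r := r) hQ hg
    refine ⟨-e, Submodule.neg_mem _ he, fun F hF => ?_⟩
    have := hgf _ ⟨F, hF, rfl⟩
    rw [faceBoundary_wedge_insert hr hQ he hF, hw f F hF, ← mul_neg] at this
    rw [map_neg, Pi.neg_apply, mul_left_cancel₀ (faceSign_ne_zero K r v F) this]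
  · intro h f hf hf0
    obtain ⟨e, he, rfl⟩ := exists_wedge_eq (r := r) hQ hf
    obtain ⟨g, hg, hge⟩ := h e he (fun F hF => by
      have := hf0 _ ⟨F, hF, rfl⟩
      rw [faceBoundary_wedge_insert hr hQ he hF, neg_eq_zero] at this
      exact (mul_eq_zero.1 this).resolve_left (faceSign_ne_zero K r v F))
    refine ⟨-wedge K r v g, Submodule.neg_mem _ (wedge_mem_chainsOn hg), ?_⟩
    rintro _ ⟨F, hF, rfl⟩
    rw [map_neg, Pi.neg_apply, faceBoundary_wedge_insert hr hQ hg hF, neg_neg, hge F hF,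
      hw e F hF]

theorem exactAt_union_image_iff (hr : Function.Injective r) (s : Finset W) {Q : Set (Finset W)}
    (hQ : ∀ F ∈ Q, Disjoint s F) (k : ℕ) :
    ExactAt K r ((s ∪ ·) '' Q) (k + s.card) ↔ ExactAt K r Q k := by
  induction s using Finset.induction_on with
  | empty => simp
  | insert v s hv ih =>
    have hQ' : ∀ F ∈ Q, v ∉ F ∧ Disjoint s F := fun F hF => Finset.disjoint_insert_left.1 (hQ F hF)
    have h := exactAt_insert_image_iff (K := K) hr (v := v) (Q := (s ∪ ·) '' Q) (by
      rintro _ ⟨F, hF, rfl⟩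
      simp [hv, (hQ' F hF).1]) (k + s.card)
    rw [Set.image_image] at h
    simpa only [Finset.card_insert_of_notMem hv, ← add_assoc, Finset.insert_union,
      ih (fun F hF => (hQ' F hF).2)] using h

/-- Homology of links in terms of the faces that contain a given one. -/
theorem nontrivial_reducedHomologyPred_link_iff (hr : Function.Injective r)
    (X : SimplicialComplexOn W) (s : Finset W) (n : ℕ) :
    Nontrivial (reducedHomologyPred K (X.link s) n) ↔
      ¬ ExactAt K r {F ∈ (X : Set (Finset W)) | s ⊆ F} (n + s.card) := by
  rw [nontrivial_reducedHomologyPred_iff hr, not_iff_not,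
    ← exactAt_union_image_iff hr s (Q := (X.link s : Set (Finset W))) (fun F hF => hF.2.1)]
  congr! 1
  ext F
  simp only [Set.mem_image, Set.mem_ofPred_eq]
  constructor
  · rintro ⟨G, hG, rfl⟩
    exact ⟨hG.2.2, Finset.subset_union_left⟩
  · rintro ⟨hF, hs⟩
    have h : s ∪ F \ s = F := Finset.union_sdiff_of_subset hs
    exact ⟨F \ s, ⟨X.lower Finset.sdiff_subset hF, Finset.disjoint_sdiff, by rwa [h]⟩, h⟩

end Exactness

/-! ### Independence of the ambient vertex set. -/

section Embedding

variable {K : Type*} [Field K] {V W : Type*} [DecidableEq V] [Fintype V] [DecidableEq W]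
  [Fintype W] (j : V ↪ W) (r : W → ℕ)

theorem faceSign_map (v : V) (F : Finset V) :
    faceSign K r (j v) (F.map j) = faceSign K (r ∘ j) v F := by
  simp [faceSign, Finset.filter_map]

theorem faceBoundary_map {f : Finset W → K} (hf : ∀ F, f F ≠ 0 → ∃ G : Finset V, G.map j = F)
    (F : Finset V) :
    faceBoundary K r f (F.map j) = faceBoundary K (r ∘ j) (fun G => f (G.map j)) F := by
  rw [faceBoundary_apply, faceBoundary_apply]
  refine (Finset.sum_of_injOn j j.injective.injOn (by simp) ?_ ?_).symm
  · intro w _ hw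
    rw [contract_apply]
    split_ifs with h
    · rfl
    · by_contra h0
      obtain ⟨G, hG⟩ := hf _ (right_ne_zero_of_mul h0)
      have hw' : w ∈ G.map j := hG ▸ Finset.mem_insert_self w _
      obtain ⟨v, -, rfl⟩ := Finset.mem_map.1 hw'
      exact hw (by simp)
  · intro v _
    rw [contract_apply, contract_apply, Finset.map_insert, faceSign_map]
    simp

/-- Restriction to the image and extension by zero are mutually inverse on chains, and vertices
outside the image contribute nothing to the boundary. -/
theorem exactAt_map_iff (Q : Set (Finset V)) (k : ℕ) :
    ExactAt K r (Finset.map j '' Q) k ↔ ExactAt K (r ∘ j) Q k := by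
  have hinj := Finset.map_injective j
  have pull : ∀ {k : ℕ} {f : Finset W → K}, f ∈ chainsOn K (Finset.map j '' Q) k →
      (fun G => f (G.map j)) ∈ chainsOn K Q k := by
    intro k f hf F hF
    obtain ⟨⟨G, hG, hGF⟩, h⟩ := hf _ hF
    exact ⟨hinj hGF ▸ hG, by simpa using h⟩
  have supp : ∀ {k : ℕ} {f : Finset W → K}, f ∈ chainsOn K (Finset.map j '' Q) k →
      ∀ F, f F ≠ 0 → ∃ G : Finset V, G.map j = F := by
    intro k f hf F hF
    obtain ⟨⟨G, -, hGF⟩, -⟩ := hf _ hF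
    exact ⟨G, hGF⟩
  have push : ∀ {k : ℕ} {f : Finset V → K}, f ∈ chainsOn K Q k →
      ∃ g ∈ chainsOn K (Finset.map j '' Q) k, (fun G => g (G.map j)) = f := by
    intro k f hf
    refine ⟨Function.extend (Finset.map j) f 0, fun F hF => ?_, ?_⟩
    · by_cases h : ∃ G : Finset V, G.map j = F
      · obtain ⟨G, rfl⟩ := h
        rw [hinj.extend_apply] at hF
        exact ⟨⟨G, (hf G hF).1, rfl⟩, by simpa using (hf G hF).2⟩
      · rw [Function.extend_apply' _ _ _ h] at hF
        exact absurd rfl hF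
    · ext G
      exact hinj.extend_apply _ _ G
  constructor
  · intro h f hf hf0
    obtain ⟨g, hg, rfl⟩ := push hf
    obtain ⟨e, he, heg⟩ := h g hg (by
      rintro _ ⟨F, hF, rfl⟩
      rw [faceBoundary_map j r (supp hg), hf0 F hF])
    refine ⟨_, pull he, fun F hF => ?_⟩
    rw [← faceBoundary_map j r (supp he), heg _ ⟨F, hF, rfl⟩]
  · intro h f hf hf0
    obtain ⟨e, he, heg⟩ := h _ (pull hf) (fun F hF => by
      rw [← faceBoundary_map j r (supp hf), hf0 _ ⟨F, hF, rfl⟩])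
    obtain ⟨g, hg, rfl⟩ := push he
    refine ⟨g, hg, ?_⟩
    rintro _ ⟨F, hF, rfl⟩
    rw [faceBoundary_map j r (supp hg), heg F hF]

end Embedding

end SimplicialComplexOn

namespace SimplicialComplexOn

/-! ### Stars in the extended complex and their fibres. -/

section Chains

variable {K : Type*} [Field K] {V S : Type*} [DecidableEq V] [Fintype V] [DecidableEq S]
  [Fintype S] {r : V ⊕ S → ℕ}

/-- The complex obtained from `Δ` by adding the faces that consist of a subset of a face `u s` and
of a chain of new vertices over it. -/
def chainExtension (Δ : SimplicialComplexOn V) (u : S → Finset V) :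
    SimplicialComplexOn (V ⊕ S) where
  carrier := {F | F.toLeft ∈ Δ ∧ (∀ s ∈ F.toRight, F.toLeft ⊆ u s) ∧
    ∀ s ∈ F.toRight, ∀ t ∈ F.toRight, u s ⊆ u t ∨ u t ⊆ u s}
  lower' := fun _ _ hba ha =>
    ⟨Δ.lower (Finset.toLeft_subset_toLeft hba) ha.1,
      fun s hs => (Finset.toLeft_subset_toLeft hba).trans
        (ha.2.1 s (Finset.toRight_subset_toRight hba hs)),
      fun s hs t ht => ha.2.2 s (Finset.toRight_subset_toRight hba hs) t
        (Finset.toRight_subset_toRight hba ht)⟩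

variable {Δ : SimplicialComplexOn V} {u : S → Finset V}

variable (Δ u) in
/-- The faces of the extension that contain `σ` and `C`. -/
def starFaces (σ : Finset V) (C : Finset S) : Set (Finset (V ⊕ S)) :=
  {F | F ∈ chainExtension Δ u ∧ σ ⊆ F.toLeft ∧ C ⊆ F.toRight}

variable (Δ u) in
/-- The faces that contain `σ` and `C` and have all their new vertices strictly over `σ`. -/
def strictStarFaces (σ : Finset V) (C : Finset S) : Set (Finset (V ⊕ S)) :=
  {F | F ∈ starFaces Δ u σ C ∧ ∀ s ∈ F.toRight, σ ⊂ u s}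

theorem ordConnected_starFaces (σ : Finset V) (C : Finset S) :
    (starFaces Δ u σ C).OrdConnected :=
  ⟨fun _ hF _ hH _ hG => ⟨(chainExtension Δ u).lower hG.2 hH.1,
    hF.2.1.trans (Finset.toLeft_subset_toLeft hG.1),
    hF.2.2.trans (Finset.toRight_subset_toRight hG.1)⟩⟩

theorem ordConnected_strictStarFaces (σ : Finset V) (C : Finset S) :
    (strictStarFaces Δ u σ C).OrdConnected :=
  ⟨fun _ hF _ hH _ hG => ⟨(ordConnected_starFaces σ C).out hF.1 hH.1 hG,
    fun s hs => hH.2 s (Finset.toRight_subset_toRight hG.2 hs)⟩⟩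

/-- The faces with vertices `σ` in `V` whose other vertices contain `C` and lie over `σ`. -/
def fiberFaces (u : S → Finset V) (σ : Finset V) (C : Finset S) : Set (Finset (V ⊕ S)) :=
  {F | F.toLeft = σ ∧ C ⊆ F.toRight ∧ (∀ s ∈ F.toRight, σ ⊆ u s) ∧
    ∀ s ∈ F.toRight, ∀ t ∈ F.toRight, u s ⊆ u t ∨ u t ⊆ u s}

/-- The faces with vertices `σ` in `V` whose other vertices contain `C` and lie strictly
over `σ`. -/
def strictFiberFaces (u : S → Finset V) (σ : Finset V) (C : Finset S) : Set (Finset (V ⊕ S)) :=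
  {F | F.toLeft = σ ∧ C ⊆ F.toRight ∧ (∀ s ∈ F.toRight, σ ⊂ u s) ∧
    ∀ s ∈ F.toRight, ∀ t ∈ F.toRight, u s ⊆ u t ∨ u t ⊆ u s}

/-- A Boolean interval of positive length is a cone over any vertex of `β` outside `σ`. -/
theorem exactAt_interval (hr : Function.Injective r) {σ β : Finset V} (h : σ ⊂ β) (D : Finset S)
    (k : ℕ) :
    ExactAt K r {F : Finset (V ⊕ S) | F.toRight = D ∧ σ ⊆ F.toLeft ∧ F.toLeft ⊆ β} k := by
  obtain ⟨v, hv, hv'⟩ := Finset.exists_of_ssubset h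
  refine ExactAt.of_toggle hr (Sum.inl v) k ?_ ?_
  · rintro F ⟨rfl, h1, h2⟩
    refine ⟨by simp, ?_, ?_⟩
    · rw [Finset.toLeft_insert_inl]
      exact h1.trans (Finset.subset_insert _ _)
    · rw [Finset.toLeft_insert_inl]
      exact Finset.insert_subset hv h2
  · rintro F ⟨rfl, h1, h2⟩
    refine ⟨?_, ?_, ?_⟩
    · ext x
      simp
    · intro x hx
      have hxv : x ≠ v := fun hxv => hv' (hxv ▸ hx)
      simpa [hxv] using h1 hx
    · intro x hx
      simp only [Finset.mem_toLeft, Finset.mem_erase] at hx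
      exact h2 (Finset.mem_toLeft.2 hx.2)

/-- The vertex `s` is comparable to every new vertex over `u s`, so it can always be added; it can
be removed because `C` does not demand it. -/
theorem exactAt_fiberFaces_of_notMem (hr : Function.Injective r) {C : Finset S} {s : S}
    (hs : s ∉ C) (k : ℕ) : ExactAt K r (fiberFaces u (u s) C) k := by
  refine ExactAt.of_toggle hr (Sum.inr s) k ?_ ?_
  · rintro F ⟨h1, h2, h3, h4⟩
    refine ⟨by simpa using h1, ?_, ?_, ?_⟩
    · rw [Finset.toRight_insert_inr]
      exact h2.trans (Finset.subset_insert _ _)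
    · rw [Finset.toRight_insert_inr]
      exact fun t ht => (Finset.mem_insert.1 ht).elim (fun h => h ▸ subset_rfl) (h3 t)
    · rw [Finset.toRight_insert_inr]
      intro t ht t' ht'
      rw [Finset.mem_insert] at ht ht'
      obtain rfl | ht := ht
      · obtain rfl | ht' := ht'
        · exact Or.inl subset_rfl
        · exact Or.inl (h3 _ ht')
      · obtain rfl | ht' := ht'
        · exact Or.inr (h3 _ ht)
        · exact h4 t ht t' ht'
  · rintro F ⟨h1, h2, h3, h4⟩
    have hsub : (F.erase (Sum.inr s)).toRight ⊆ F.toRight :=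
      Finset.toRight_subset_toRight (Finset.erase_subset _ _)
    refine ⟨?_, ?_, fun t ht => h3 t (hsub ht), fun t ht t' ht' => h4 t (hsub ht) t' (hsub ht')⟩
    · rw [← h1]
      ext x
      simp
    · intro x hx
      have hxs : x ≠ s := fun h => hs (h ▸ hx)
      simpa [hxs] using h2 hx

/-- Every member contains `s`, and by injectivity of `u` its remaining new vertices lie strictly
over `u s`. -/
theorem fiberFaces_of_mem (hu : Function.Injective u) {C : Finset S} {s : S} (hs : s ∈ C) :
    fiberFaces u (u s) C = insert (Sum.inr s) '' strictFiberFaces u (u s) (C.erase s) := by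
  ext F
  constructor
  · rintro ⟨h1, h2, h3, h4⟩
    have hsF : Sum.inr s ∈ F := Finset.mem_toRight.1 (h2 hs)
    have hsub : (F.erase (Sum.inr s)).toRight ⊆ F.toRight :=
      Finset.toRight_subset_toRight (Finset.erase_subset _ _)
    refine ⟨F.erase (Sum.inr s), ⟨?_, ?_, ?_, ?_⟩, Finset.insert_erase hsF⟩
    · rw [← h1]
      ext x
      simp
    · intro x hx
      rw [Finset.mem_erase] at hx
      simpa [hx.1] using h2 hx.2
    · intro t ht
      refine (h3 t (hsub ht)).ssubset_of_ne fun h => ?_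
      rw [← hu h] at ht
      simp at ht
    · exact fun t ht t' ht' => h4 t (hsub ht) t' (hsub ht')
  · rintro ⟨G, ⟨h1, h2, h3, h4⟩, rfl⟩
    refine ⟨by simpa using h1, ?_, ?_, ?_⟩
    · rw [Finset.toRight_insert_inr]
      intro x hx
      by_cases hxs : x = s
      · exact hxs ▸ Finset.mem_insert_self _ _
      · exact Finset.mem_insert_of_mem (h2 (Finset.mem_erase.2 ⟨hxs, hx⟩))
    · rw [Finset.toRight_insert_inr]
      exact fun t ht => (Finset.mem_insert.1 ht).elim (fun h => h ▸ subset_rfl)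
        (fun h => (h3 t h).subset)
    · rw [Finset.toRight_insert_inr]
      intro t ht t' ht'
      rw [Finset.mem_insert] at ht ht'
      obtain rfl | ht := ht
      · obtain rfl | ht' := ht'
        · exact Or.inl subset_rfl
        · exact Or.inl (h3 _ ht').subset
      · obtain rfl | ht' := ht'
        · exact Or.inr (h3 _ ht).subset
        · exact h4 t ht t' ht'

theorem exactAt_fiberFaces_succ_iff (hr : Function.Injective r) (hu : Function.Injective u)
    {C : Finset S} {s : S} (hs : s ∈ C) (k : ℕ) :
    ExactAt K r (fiberFaces u (u s) C) (k + 1) ↔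
      ExactAt K r (strictFiberFaces u (u s) (C.erase s)) k := by
  rw [fiberFaces_of_mem hu hs, exactAt_insert_image_iff hr]
  rintro F ⟨-, -, h, -⟩ hF
  exact (h s (Finset.mem_toRight.2 hF)).ne rfl

/-- The faces of `starFaces` with at least one new vertex form an exact family. -/
theorem exactAt_strictStarFaces_inter (hr : Function.Injective r) (hΔ : ∀ s, u s ∈ Δ)
    (σ : Finset V) (C : Finset S) (k : ℕ) :
    ExactAt K r (strictStarFaces Δ u σ C ∩ {F | F.toRight.Nonempty}) k := by
  refine ExactAt.of_fibers hr Finset.toRight_monotone ?_ ?_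
  · exact (ordConnected_strictStarFaces σ C).inter
      ⟨fun F hF _ _ _ hG => Finset.Nonempty.mono (Finset.toRight_subset_toRight hG.1) hF⟩
  · rintro F ⟨⟨⟨hF, -, hC⟩, hs⟩, hne⟩
    -- The smallest face of the chain is the only bound on the part in `V`, so the fibre is the
    -- interval from `σ` to `u s`, nondegenerate by strictness.
    obtain ⟨s, hsF, hmin⟩ := F.toRight.exists_min_image (fun s => (u s).card) hne
    have hmin' : ∀ t ∈ F.toRight, u s ⊆ u t := fun t ht => by
      rcases hF.2.2 s hsF t ht with h | h
      · exact h
      · exact (Finset.eq_of_subset_of_card_le h (hmin t ht)).symm.subset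
    convert exactAt_interval (K := K) hr (hs s hsF) F.toRight k using 1
    ext G
    constructor
    · rintro ⟨⟨⟨⟨hG, hσ, -⟩, -⟩, -⟩, hGF⟩
      exact ⟨hGF, hσ, hG.2.1 s (hGF ▸ hsF)⟩
    · rintro ⟨hGF, hσ, hs'⟩
      refine ⟨⟨⟨⟨⟨Δ.lower hs' (hΔ s), ?_, ?_⟩, hσ, ?_⟩, ?_⟩, ?_⟩, hGF⟩
      · exact fun t ht => hs'.trans (hmin' t (hGF ▸ ht))
      · rw [hGF]
        exact hF.2.2
      · rwa [hGF]
      · rwa [hGF]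
      · rwa [Set.mem_ofPred_eq, hGF]

theorem exactAt_strictStarFaces_of_nonempty (hr : Function.Injective r) (hΔ : ∀ s, u s ∈ Δ)
    (σ : Finset V) {C : Finset S} (hC : C.Nonempty) (k : ℕ) :
    ExactAt K r (strictStarFaces Δ u σ C) k := by
  convert exactAt_strictStarFaces_inter (K := K) hr hΔ σ C k using 1
  exact (Set.inter_eq_left.2 fun F hF => hC.mono hF.1.2.2).symm

/-- The faces with a new vertex form an upper part that is exact in all degrees; removing it leaves
the star of `σ` in `Δ`. -/
theorem exactAt_strictStarFaces_empty_iff (hr : Function.Injective r) (hΔ : ∀ s, u s ∈ Δ)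
    (σ : Finset V) (k : ℕ) :
    ExactAt K r (strictStarFaces Δ u σ ∅) k ↔
      ExactAt K (r ∘ Sum.inl) {ρ ∈ (Δ : Set (Finset V)) | σ ⊆ ρ} k := by
  have key : strictStarFaces Δ u σ ∅ \ {F | F.toRight.Nonempty} =
      Finset.map Function.Embedding.inl '' {ρ ∈ (Δ : Set (Finset V)) | σ ⊆ ρ} := by
    ext F
    constructor
    · rintro ⟨⟨⟨hF, hσ, -⟩, -⟩, hne⟩
      rw [Set.mem_ofPred_eq, Finset.not_nonempty_iff_eq_empty] at hne
      refine ⟨F.toLeft, ⟨hF.1, hσ⟩, ?_⟩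
      conv_rhs => rw [← Finset.toLeft_disjSum_toRight (u := F), hne, Finset.disjSum_empty]
    · rintro ⟨G, ⟨hG, hσ⟩, rfl⟩
      rw [← Finset.disjSum_empty]
      refine ⟨⟨⟨⟨?_, ?_, ?_⟩, ?_, ?_⟩, ?_⟩, ?_⟩ <;>
        simp only [Finset.toLeft_disjSum, Finset.toRight_disjSum, Set.mem_ofPred_eq,
          Finset.not_nonempty_empty, not_false_eq_true, Finset.notMem_empty, false_imp_iff,
          implies_true, subset_rfl]
      · exact hG
      · exact hσ
  have hup : ∀ F ∈ {F : Finset (V ⊕ S) | F.toRight.Nonempty} ∩ strictStarFaces Δ u σ ∅,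
      ∀ G ∈ strictStarFaces Δ u σ ∅, F ⊆ G → G ∈ {F : Finset (V ⊕ S) | F.toRight.Nonempty} :=
    fun F hF G _ hFG => hF.1.mono (Finset.toRight_subset_toRight hFG)
  rw [show r ∘ Sum.inl = r ∘ (Function.Embedding.inl : V ↪ V ⊕ S) from rfl, ← exactAt_map_iff,
    ← key]
  constructor
  · exact fun h => h.diff_of_inter hr (ordConnected_strictStarFaces σ ∅) hup
      (exactAt_strictStarFaces_inter hr hΔ σ ∅ (k + 1))
  · exact fun h => ExactAt.of_diff_of_inter hr (ordConnected_strictStarFaces σ ∅) hup h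
      (exactAt_strictStarFaces_inter hr hΔ σ ∅ k)

/-! ### Stars of large faces, all of which carry a new vertex. -/

variable {m : ℕ}

/-- In the fibration by the part in `V`, every such part is large enough to be some `u s`; for `s ∉
C` its fibre is a cone. -/
theorem exactAt_starFaces_of_fibers (hr : Function.Injective r)
    (hS : ∀ τ ∈ Δ, m ≤ τ.card → ∃ s, u s = τ) {σ : Finset V} (hσ : m ≤ σ.card) {C : Finset S}
    {k : ℕ} (h : ∀ s ∈ C, ExactAt K r (fiberFaces u (u s) C) k) :
    ExactAt K r (starFaces Δ u σ C) k := by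
  refine ExactAt.of_fibers hr Finset.toLeft_monotone (ordConnected_starFaces σ C) ?_
  rintro F ⟨hF, hσF, -⟩
  obtain ⟨s, hs⟩ := hS _ hF.1 (hσ.trans (Finset.card_le_card hσF))
  have : {G ∈ starFaces Δ u σ C | G.toLeft = F.toLeft} = fiberFaces u (u s) C := by
    ext G
    constructor
    · rintro ⟨⟨hG, -, hC⟩, hGF⟩
      exact ⟨hGF.trans hs.symm, hC, (hGF.trans hs.symm) ▸ hG.2.1, hG.2.2⟩
    · rintro ⟨h1, h2, h3, h4⟩
      refine ⟨⟨⟨?_, ?_, h4⟩, ?_, h2⟩, h1.trans hs⟩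
      · rw [h1, hs]
        exact hF.1
      · rwa [h1]
      · rwa [h1, hs]
  rw [this]
  by_cases hsC : s ∈ C
  · exact h s hsC
  · exact exactAt_fiberFaces_of_notMem hr hsC k

/-- The same fibration away from `σ`: new vertices over a part strictly larger than `σ` are
automatically strictly over `σ`. -/
theorem exactAt_strictStarFaces_upper (hr : Function.Injective r)
    (hS : ∀ τ ∈ Δ, m ≤ τ.card → ∃ s, u s = τ) {σ : Finset V} (hσ : m ≤ σ.card) {C : Finset S}
    {k : ℕ} (h : ∀ s ∈ C, σ ⊂ u s → ExactAt K r (fiberFaces u (u s) C) k) :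
    ExactAt K r (strictStarFaces Δ u σ C ∩ {F | F.toLeft ≠ σ}) k := by
  refine ExactAt.of_fibers hr Finset.toLeft_monotone ⟨?_⟩ ?_
  · rintro F hF H hH G hG
    refine ⟨(ordConnected_strictStarFaces σ C).out hF.1 hH.1 hG, fun hGσ => hF.2 ?_⟩
    exact (hGσ ▸ Finset.toLeft_subset_toLeft hG.1).antisymm hF.1.1.2.1
  rintro F ⟨⟨⟨hF, hσF, -⟩, -⟩, hne⟩
  have hσF' : σ ⊂ F.toLeft := hσF.ssubset_of_ne (Ne.symm hne)
  obtain ⟨s, hs⟩ := hS _ hF.1 (hσ.trans (Finset.card_le_card hσF))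
  have : {G ∈ strictStarFaces Δ u σ C ∩ {F | F.toLeft ≠ σ} | G.toLeft = F.toLeft} =
      fiberFaces u (u s) C := by
    ext G
    constructor
    · rintro ⟨⟨⟨⟨hG, -, hC⟩, -⟩, -⟩, hGF⟩
      exact ⟨hGF.trans hs.symm, hC, (hGF.trans hs.symm) ▸ hG.2.1, hG.2.2⟩
    · rintro ⟨h1, h2, h3, h4⟩
      rw [hs] at h1
      refine ⟨⟨⟨⟨⟨?_, ?_, h4⟩, ?_, h2⟩, ?_⟩, ?_⟩, h1⟩
      · rw [h1]
        exact hF.1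
      · rwa [h1, ← hs]
      · rwa [h1]
      · exact fun t ht => hσF'.trans_subset (hs ▸ h3 t ht)
      · rwa [Set.mem_ofPred_eq, h1]
  rw [this]
  by_cases hsC : s ∈ C
  · exact h s hsC (hs ▸ hσF')
  · exact exactAt_fiberFaces_of_notMem hr hsC k

theorem strictStarFaces_diff {σ : Finset V} (hσ : σ ∈ Δ) (C : Finset S) :
    strictStarFaces Δ u σ C \ {F | F.toLeft ≠ σ} = strictFiberFaces u σ C := by
  ext F
  constructor
  · rintro ⟨⟨⟨hF, -, hC⟩, hs⟩, hne⟩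
    exact ⟨not_not.1 hne, hC, hs, hF.2.2⟩
  · rintro ⟨h1, h2, h3, h4⟩
    refine ⟨⟨⟨⟨?_, ?_, h4⟩, ?_, h2⟩, h3⟩, not_not.2 h1⟩
    · rwa [h1]
    · exact fun s hs => h1 ▸ (h3 s hs).subset
    · rw [h1]

theorem mem_upper_of_subset {σ : Finset V} {C : Finset S} :
    ∀ F ∈ {F : Finset (V ⊕ S) | F.toLeft ≠ σ} ∩ strictStarFaces Δ u σ C,
      ∀ G ∈ strictStarFaces Δ u σ C, F ⊆ G → G ∈ {F : Finset (V ⊕ S) | F.toLeft ≠ σ} :=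
  fun _ hF _ _ hFG hGσ =>
    hF.1 ((hGσ ▸ Finset.toLeft_subset_toLeft hFG).antisymm hF.2.1.2.1)

/-- The strict fibre is the strict star minus an upper part. For `C = ∅` that part is exact and the
strict star behaves like the star in `Δ`, as for a barycentric subdivision. For `C ≠ ∅` the strict
star is exact, and the fibres of the upper part over members of `C` reduce to strict fibres with one
element of `C` removed. -/
theorem exactAt_strictFiberFaces (hr : Function.Injective r) (hu : Function.Injective u)
    (hΔ : ∀ s, u s ∈ Δ) (hS : ∀ τ ∈ Δ, m ≤ τ.card → ∃ s, u s = τ) {k : ℕ}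
    (H : ∀ τ ∈ Δ, m ≤ τ.card →
      ExactAt K (r ∘ Sum.inl) {ρ ∈ (Δ : Set (Finset V)) | τ ⊆ ρ} k)
    (C : Finset S) {τ : Finset V} (hτ : τ ∈ Δ) (hm : m ≤ τ.card) :
    ExactAt K r (strictFiberFaces u τ C) k := by
  induction hn : C.card generalizing C τ with
  | zero =>
    rw [Finset.card_eq_zero] at hn
    subst hn
    rw [← strictStarFaces_diff hτ]
    exact ((exactAt_strictStarFaces_empty_iff hr hΔ τ k).2 (H τ hτ hm)).diff_of_inter hr
      (ordConnected_strictStarFaces _ _) mem_upper_of_subset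
      (exactAt_strictStarFaces_upper hr hS hm (by simp))
  | succ n ih =>
    rw [← strictStarFaces_diff hτ]
    refine (exactAt_strictStarFaces_of_nonempty hr hΔ τ
      (Finset.card_pos.1 (by omega)) k).diff_of_inter hr
      (ordConnected_strictStarFaces _ _) mem_upper_of_subset
      (exactAt_strictStarFaces_upper hr hS hm fun s hs hτs => ?_)
    rw [exactAt_fiberFaces_succ_iff hr hu hs]
    refine ih _ (hΔ s) (hm.trans (Finset.card_le_card hτs.subset)) ?_
    rw [Finset.card_erase_of_mem hs, hn, Nat.add_sub_cancel]

theorem exactAt_link_of_strictFiberFaces (hr : Function.Injective r)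
    (hΔ : ∀ s, u s ∈ Δ) (hS : ∀ τ ∈ Δ, m ≤ τ.card → ∃ s, u s = τ) {k : ℕ}
    {τ : Finset V} (hτ : τ ∈ Δ) (hm : m ≤ τ.card)
    (h : ExactAt K r (strictFiberFaces u τ ∅) k) :
    ExactAt K (r ∘ Sum.inl) {ρ ∈ (Δ : Set (Finset V)) | τ ⊆ ρ} k := by
  rw [← exactAt_strictStarFaces_empty_iff hr hΔ]
  rw [← strictStarFaces_diff hτ] at h
  exact ExactAt.of_diff_of_inter hr (ordConnected_strictStarFaces _ _) mem_upper_of_subset h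
    (exactAt_strictStarFaces_upper hr hS hm (by simp))

/-- The degree rises by one because the fibre over `u s` with `s ∈ C` always contains the vertex `s`
itself. -/
theorem exactAt_starFaces (hr : Function.Injective r) (hu : Function.Injective u)
    (hΔ : ∀ s, u s ∈ Δ) (hm : ∀ s, m ≤ (u s).card) (hS : ∀ τ ∈ Δ, m ≤ τ.card → ∃ s, u s = τ)
    {k : ℕ} (H : ∀ τ ∈ Δ, m ≤ τ.card →
      ExactAt K (r ∘ Sum.inl) {ρ ∈ (Δ : Set (Finset V)) | τ ⊆ ρ} k)
    {σ : Finset V} (hσ : m ≤ σ.card) (C : Finset S) :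
    ExactAt K r (starFaces Δ u σ C) (k + 1) :=
  exactAt_starFaces_of_fibers hr hS hσ fun s hs =>
    (exactAt_fiberFaces_succ_iff hr hu hs k).2
      (exactAt_strictFiberFaces hr hu hΔ hS H _ (hΔ s) (hm s))

theorem starFaces_eq_strictStarFaces (hm : ∀ s, m ≤ (u s).card) {σ : Finset V} (hσ : σ.card < m)
    (C : Finset S) : starFaces Δ u σ C = strictStarFaces Δ u σ C := by
  ext F
  refine ⟨fun hF => ⟨hF, fun s hs => ?_⟩, fun hF => hF.1⟩
  refine (hF.2.1.trans (hF.1.2.1 s hs)).ssubset_of_ne fun h => ?_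
  exact absurd (hm s) (by rw [← h]; omega)

/-- The members of a chain have distinct sizes, between the size of the part in `V` and `N`. -/
theorem card_le_of_mem_chainExtension {N : ℕ} (hu : Function.Injective u)
    (hm : ∀ s, m ≤ (u s).card) (hN : ∀ τ ∈ Δ, τ.card ≤ N) (hΔ : ∀ s, u s ∈ Δ)
    {F : Finset (V ⊕ S)} (hF : F ∈ chainExtension Δ u) : F.card ≤ N + 1 := by
  have h1 : F.toRight.card ≤ (Finset.Icc (max m F.toLeft.card) N).card := by
    refine Finset.card_le_card_of_injOn (fun s => (u s).card) ?_ ?_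
    · intro s hs
      simp only [Finset.coe_Icc, Set.mem_Icc, max_le_iff]
      exact ⟨⟨hm s, Finset.card_le_card (hF.2.1 s hs)⟩, hN _ (hΔ s)⟩
    · intro s hs t ht hst
      apply hu
      rcases hF.2.2 s hs t ht with h | h
      · exact Finset.eq_of_subset_of_card_le h hst.ge
      · exact (Finset.eq_of_subset_of_card_le h hst.le).symm
  rw [Nat.card_Icc] at h1
  have h2 := hN _ hF.1
  rw [← Finset.card_toLeft_add_card_toRight (u := F)]
  omega

end Chains

end SimplicialComplexOn

namespace SimplicialComplexOn

/-! ### Sizes of the faces whose links have homology. -/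

section DegreeType

variable {K : Type*} [Field K] {V : Type*} [DecidableEq V]

theorem linkHasHomology_iff [Fintype V] {r : V → ℕ} (hr : Function.Injective r)
    {X : SimplicialComplexOn V} {n : ℕ} {σ : Finset V} :
    LinkHasHomology K X n σ ↔
      σ ∈ X ∧ ¬ ExactAt K r {F ∈ (X : Set (Finset V)) | σ ⊆ F} (n + σ.card) := by
  rw [LinkHasHomology, nontrivial_reducedHomologyPred_link_iff hr]

theorem not_exactAt_singleton [Fintype V] {r : V → ℕ} (σ : Finset V) :
    ¬ ExactAt K r {σ} σ.card := by
  intro h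
  obtain ⟨g, hg, hgf⟩ := h (Pi.single σ 1)
    (fun F hF => by
      have : F = σ := by
        by_contra h
        simp [h] at hF
      exact ⟨this, congrArg _ this⟩)
    (by
      rintro F rfl
      by_contra h
      obtain ⟨v, hv, hv'⟩ := faceBoundary_ne_zero h
      rw [Pi.single_apply, if_neg (Finset.insert_ne_self.2 hv)] at hv'
      exact hv' rfl)
  have hg0 : g = 0 := by
    ext F
    by_contra hF
    obtain ⟨rfl, h2⟩ := hg F hF
    omega
  have := hgf σ rfl
  simp [hg0] at this

theorem exists_face_of_linkHasHomology [Finite V] {X : SimplicialComplexOn V} {n : ℕ}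
    {σ : Finset V} (h : LinkHasHomology K X n σ) : ∃ F ∈ X, F.card = n + σ.card := by
  have := Fintype.ofFinite V
  obtain ⟨r, hr⟩ := Countable.exists_injective_nat V
  by_contra! hF
  exact ((linkHasHomology_iff hr).1 h).2 (exactAt_of_forall_card_ne fun F hFX => hF F hFX.1)

/-- A facet containing `τ` is the only face in its own star. Hence `s 0` bounds the size of every
face. -/
theorem exists_linkHasHomology_zero_of_mem [Finite V] {X : SimplicialComplexOn V} {τ : Finset V}
    (hτ : τ ∈ X) : ∃ σ, τ ⊆ σ ∧ LinkHasHomology K X 0 σ := by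
  have := Fintype.ofFinite V
  obtain ⟨r, hr⟩ := Countable.exists_injective_nat V
  obtain ⟨σ, hτσ, hσ⟩ := (Set.toFinite (X : Set (Finset V))).exists_le_maximal hτ
  refine ⟨σ, hτσ, (linkHasHomology_iff hr).2 ⟨hσ.prop, ?_⟩⟩
  have : {F ∈ (X : Set (Finset V)) | σ ⊆ F} = {σ} := by
    ext F
    constructor
    · exact fun hF => (hσ.le_of_ge hF.1 hF.2).antisymm hF.2
    · rintro rfl
      exact ⟨hσ.prop, subset_rfl⟩
  rw [this, zero_add]
  exact not_exactAt_singleton σ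

theorem dim_eq_of_isGreatest {X : SimplicialComplexOn V} {N : ℕ}
    (h : IsGreatest (Finset.card '' (X : Set (Finset V))) N) : X.dim = N - 1 := by
  rw [dim, h.csSup_eq]

/-- The faces of `phi i Δ` whose links have homology, when the sizes of those of `Δ` are given by
`s` with `s j = s 0 - j` for `j < i`. -/
theorem linkHasHomology_phi [Fintype V] {Δ : SimplicialComplexOn V} {p i : ℕ}
    (hi : 1 ≤ i) (hip : i ≤ p) {s : ℕ → ℕ}
    (hp : ∀ n σ, LinkHasHomology K Δ n σ → n ≤ p ∧ σ.card = s n)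
    (hex : ∀ j ≤ p, ∃ σ, LinkHasHomology K Δ j σ)
    (hanti : ∀ j, 1 ≤ j → j ≤ p → s j ≤ s (j - 1))
    (hone : ∀ j < i, s j + j = s 0) :
    s i < s (i - 1) ∧
    (∀ n F, LinkHasHomology K (phi i Δ) n F →
      n ≤ p ∧ F.card = if n < i then s n + 1 else s n) ∧
    ∀ j ≤ p, ∃ F, LinkHasHomology K (phi i Δ) j F := by
  -- With `dim Δ = s 0 - 1` this identifies `s (i - 1)` with the threshold `dim Δ + 2 - i` for new
  -- vertices.
  have hm := hone (i - 1) (by omega)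
  have hle : ∀ τ ∈ Δ, τ.card ≤ s 0 := fun τ hτ => by
    obtain ⟨σ, hτσ, hσ⟩ := exists_linkHasHomology_zero_of_mem (K := K) hτ
    exact (hp 0 σ hσ).2 ▸ Finset.card_le_card hτσ
  have hdim : Δ.dim = s 0 - 1 := by
    refine dim_eq_of_isGreatest ⟨?_, ?_⟩
    · obtain ⟨σ, hσ⟩ := hex 0 (Nat.zero_le _)
      exact ⟨σ, hσ.1, (hp 0 σ hσ).2⟩
    · rintro _ ⟨τ, hτ, rfl⟩
      exact hle τ hτ
  -- Homology at index `i` needs a face of size `i + s i`, at most `s 0 = s (i - 1) + i - 1`.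
  have hsi : s i < s (i - 1) := by
    obtain ⟨σ, hσ⟩ := hex i hip
    obtain ⟨F, hF, hFc⟩ := exists_face_of_linkHasHomology hσ
    have h1 := hle F hF
    have h2 := (hp i σ hσ).2
    omega
  have hanti' : ∀ j, i ≤ j → j ≤ p → s j ≤ s i := by
    intro j hij
    induction j, hij using Nat.le_induction with
    | base => exact fun _ => le_rfl
    | succ j hij ih =>
      intro hj
      exact (hanti (j + 1) (by omega) hj).trans (ih (by omega))
  have : Finite (NewVertex i Δ) :=
    inferInstanceAs (Finite {τ : Finset V // τ ∈ Δ ∧ Δ.dim + 2 - (i : ℤ) ≤ (τ.card : ℤ)})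
  have := Fintype.ofFinite (NewVertex i Δ)
  obtain ⟨r, hr⟩ := Countable.exists_injective_nat (V ⊕ NewVertex i Δ)
  have hr' : Function.Injective (r ∘ Sum.inl : V → ℕ) := hr.comp Sum.inl_injective
  let u : NewVertex i Δ → Finset V := fun τ => τ.1
  have hu : Function.Injective u := Subtype.val_injective
  have hΔ : ∀ t, u t ∈ Δ := fun t => t.2.1
  have hmu : ∀ t, s (i - 1) ≤ (u t).card := fun t => by
    have h : Δ.dim + 2 - (i : ℤ) ≤ ((u t).card : ℤ) := t.2.2
    omega
  have hS : ∀ τ ∈ Δ, s (i - 1) ≤ τ.card → ∃ t, u t = τ := fun τ hτ h =>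
    ⟨⟨τ, hτ, by omega⟩, rfl⟩
  -- A face of size at least `s (i - 1)` has link homology only at indices `n < i`, that is, at
  -- total size `s n + n = s 0`.
  have H : ∀ k < s 0, ∀ τ ∈ Δ, s (i - 1) ≤ τ.card →
      ExactAt K (r ∘ Sum.inl) {ρ ∈ (Δ : Set (Finset V)) | τ ⊆ ρ} k := by
    intro k hk τ hτ hτm
    by_cases hkτ : k < τ.card
    · exact exactAt_of_forall_card_ne fun F hF => by
        have := Finset.card_le_card hF.2
        omega
    by_contra h
    obtain ⟨h1, h2⟩ := hp (k - τ.card) τ ((linkHasHomology_iff hr').2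
      ⟨hτ, by rwa [Nat.sub_add_cancel (not_lt.1 hkτ)]⟩)
    by_cases hn : k - τ.card < i
    · have := hone _ hn
      omega
    · have := hanti' _ (not_lt.1 hn) h1
      omega
  have hstar : ∀ F : Finset (V ⊕ NewVertex i Δ),
      {G ∈ (phi i Δ : Set (Finset (V ⊕ NewVertex i Δ))) | F ⊆ G} =
        starFaces Δ u F.toLeft F.toRight := by
    intro F
    ext G
    -- `phi i Δ` unfolds to `chainExtension Δ u`.
    refine and_congr Iff.rfl ?_
    rw [← Finset.disjSum_subset, Finset.toLeft_disjSum_toRight]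
  have hsmall : ∀ σ : Finset V, σ.card < s (i - 1) → ∀ k,
      (ExactAt K r (starFaces Δ u σ ∅) k ↔
        ExactAt K (r ∘ Sum.inl) {ρ ∈ (Δ : Set (Finset V)) | σ ⊆ ρ} k) := fun σ hσ k => by
    rw [starFaces_eq_strictStarFaces hmu hσ, exactAt_strictStarFaces_empty_iff hr hΔ]
  refine ⟨hsi, ?_, ?_⟩
  · intro n F hF
    have hFc := Finset.card_toLeft_add_card_toRight (u := F)
    obtain ⟨hFΓ, hFe⟩ := (linkHasHomology_iff hr).1 hF
    rw [hstar] at hFe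
    by_cases hσ : F.toLeft.card < s (i - 1)
    · obtain hC | hC := F.toRight.eq_empty_or_nonempty
      · rw [hC, hsmall _ hσ] at hFe
        rw [hC, Finset.card_empty, add_zero] at hFc
        rw [← hFc] at hFe ⊢
        obtain ⟨h1, h2⟩ := hp n F.toLeft ((linkHasHomology_iff hr').2 ⟨hFΓ.1, hFe⟩)
        refine ⟨h1, ?_⟩
        rw [if_neg, h2]
        intro hn
        have := hone n hn
        omega
      · refine absurd ?_ hFe
        rw [starFaces_eq_strictStarFaces hmu hσ]
        exact exactAt_strictStarFaces_of_nonempty hr hΔ _ hC _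
    · rw [not_lt] at hσ
      have hC : F.toRight.Nonempty := by
        by_contra hC
        rw [Finset.not_nonempty_iff_eq_empty] at hC
        rw [hC] at hFe
        exact hFe (exactAt_starFaces_of_fibers hr hS hσ (by simp))
      have hCc := Finset.card_pos.2 hC
      have h1 : s 0 + 1 ≤ n + F.card := by
        by_contra! h
        obtain ⟨k, hk⟩ : ∃ k, n + F.card = k + 1 := ⟨n + F.card - 1, by omega⟩
        rw [hk] at hFe
        -- Exactness in `Δ` below size `s 0` gives exactness here up to size `s 0`.
        exact hFe (exactAt_starFaces hr hu hΔ hmu hS (H k (by omega)) hσ _)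
      have h2 : n + F.card ≤ s 0 + 1 := by
        obtain ⟨G, hG, hGc⟩ := exists_face_of_linkHasHomology hF
        have := card_le_of_mem_chainExtension (u := u) hu hmu hle hΔ hG
        omega
      -- `F` has at least `s (i - 1)` old vertices and one new vertex, while `n + F.card = s 0 + 1`.
      have hn : n < i := by omega
      have := hone n hn
      rw [if_pos hn]
      omega
  · intro j hj
    obtain ⟨τ, hτ⟩ := hex j hj
    have hτc := (hp j τ hτ).2
    obtain ⟨hτΔ, hτe⟩ := (linkHasHomology_iff hr').1 hτ
    by_cases hji : j < i
    · have hτm : s (i - 1) ≤ τ.card := by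
        have := hone j hji
        omega
      obtain ⟨t, rfl⟩ := hS τ hτΔ hτm
      have hΓ : (u t).disjSum {t} ∈ phi i Δ := by
        refine ⟨?_, ?_, ?_⟩ <;> simp only [Finset.toLeft_disjSum, Finset.toRight_disjSum]
        · exact hτΔ
        · simp [u]
        · simp
      refine ⟨(u t).disjSum {t}, (linkHasHomology_iff hr).2 ⟨hΓ, fun h => hτe ?_⟩⟩
      rw [hstar, Finset.card_disjSum, Finset.card_singleton, ← add_assoc, Finset.toLeft_disjSum,
        Finset.toRight_disjSum] at h
      refine exactAt_link_of_strictFiberFaces hr hΔ hS hτΔ hτm ?_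
      rw [← Finset.erase_singleton t, ← exactAt_fiberFaces_succ_iff hr hu (by simp)]
      convert h using 1
      -- A face whose part in `V` contains `u t` and which has the new vertex `t` has part exactly
      -- `u t`, so this star is a single fibre.
      ext F
      constructor
      · rintro ⟨h1, h2, h3, h4⟩
        exact ⟨⟨h1.symm ▸ hΔ t, h1.symm ▸ h3, h4⟩, h1.symm.subset, h2⟩
      · rintro ⟨⟨-, h2, h3⟩, h4, h5⟩
        have h6 : F.toLeft = u t := (h2 t (h5 (Finset.mem_singleton_self t))).antisymm h4
        exact ⟨h6, h5, h6 ▸ h2, h3⟩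
    · refine ⟨τ.disjSum ∅, (linkHasHomology_iff hr).2 ⟨?_, fun h => hτe ?_⟩⟩
      · refine ⟨?_, ?_, ?_⟩ <;>
          simp only [Finset.toLeft_disjSum, Finset.toRight_disjSum, Finset.notMem_empty,
            false_imp_iff, implies_true]
        exact hτΔ
      · rw [hstar, Finset.card_disjSum, Finset.card_empty, add_zero, Finset.toLeft_disjSum,
          Finset.toRight_disjSum, hsmall τ] at h
        · exact h
        · have := hanti' j (not_lt.1 hji) hj
          omega

end DegreeType

end SimplicialComplexOn

theorem mainTheorem2 {K : Type*} [Field K] {V : Type*} [Fintype V] [DecidableEq V]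
    (Δ : SimplicialComplexOn V) (p i : ℕ) (hi : 1 ≤ i) (hip : i ≤ p) (d : ℕ → ℕ)
    (hd : ∀ j, 1 ≤ j → j < i → d j = 1)
    (hPR : SimplicialComplexOn.IsPR K Δ)
    (hdeg : SimplicialComplexOn.HasDegreeType K Δ p d) :
    SimplicialComplexOn.IsPR K (SimplicialComplexOn.phi i Δ) ∧
      SimplicialComplexOn.HasDegreeType K (SimplicialComplexOn.phi i Δ) p
        (fun j => if j = i then d j + 1 else d j) := by
  obtain ⟨hgreat, s, hs, hds⟩ := hdeg
  -- The trailing ones in the degree type make `s` drop by one at each step below `i`.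
  have hone : ∀ j < i, s j + j = s 0 := by
    intro j
    induction j with
    | zero => simp
    | succ j ih =>
      intro hj
      have h1 := ih (by omega)
      have h2 := hds (j + 1) (by omega) (by omega)
      rw [hd (j + 1) (by omega) hj, Nat.add_sub_cancel] at h2
      omega
  obtain ⟨hsi, hΓ, hex⟩ := SimplicialComplexOn.linkHasHomology_phi hi hip
    (fun n σ h => ⟨hgreat.2 ⟨σ, h⟩, (hs n (hgreat.2 ⟨σ, h⟩)).2 σ h⟩) (fun j hj => (hs j hj).1)
    (fun j h1 h2 => by have := hds j h1 h2; omega) hone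
  refine ⟨fun n σ τ hσ hτ => (hΓ n σ hσ).2.trans (hΓ n τ hτ).2.symm,
    ⟨hex p le_rfl, fun n ⟨F, hF⟩ => (hΓ n F hF).1⟩, fun n => if n < i then s n + 1 else s n,
    fun j hj => ⟨hex j hj, fun F hF => (hΓ j F hF).2⟩, fun j h1 h2 => ?_⟩
  have h3 := hds j h1 h2
  dsimp only
  -- Below `i` both sizes are raised and above `i` neither is; at `j = i` only `s (i - 1)` is
  -- raised.
  rcases lt_trichotomy j i with h | rfl | h
  · rw [if_neg h.ne, if_pos h, if_pos (by omega)]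
    push_cast
    omega
  · rw [if_pos rfl, if_neg (lt_irrefl j), if_pos (by omega)]
    push_cast
    omega
  · rw [if_neg h.ne', if_neg (by omega), if_neg (by omega)]
    exact h3
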